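/- Let $K$ be a field, $m\ge 0$ an integer and $n=m+3$. Over a supercommutative $K$-algebra $R=R_{\bar 0}\oplus R_{\bar 1}$ (odd elements square to zero), consider sequences $(a_i)_{i\in\mathbb Z}$ in $R_{\bar 0}$ and $(\beta_i)_{i\in\mathbb Z}$ in $R_{\bar 1}$ with $a_{i+n}=a_i$ and $\beta_{i+n}=-\beta_i$, and define $f_{j,i}$ and $\varphi_{j,i}$ for $i\ge j-2$ by $$ \begin{pmatrix} f_{j,i-1}\\ f_{j,i}\\ \varphi_{j,i}\end{pmatrix} =\begin{pmatrix}0&1&0\\-1&a_i&-\beta_i\\0&\beta_i&1\end{pmatrix} \begin{pmatrix} f_{j,i-2}\\ f_{j,i-1}\\ \varphi_{j,i-1}\end{pmatrix}, \qquad (f_{j,j-3},f_{j,j-2},\varphi_{j,j-2})=(-1,0,0). $$ The pair $(a,\beta)$ is called a superfrieze of width $m$ over $R$ if $f_{j,j+m}=1$, $f_{j,j+m+1}=0$ and $\varphi_{j,j+m+1}=0$ for all $j\in\mathbb Z$. Let $\mathcal A$ be the quotient of the polynomial superalgebra $K[a_1,\dots,a_n\,|\,\beta_1,\dots,\beta_n]$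 ($a_i$ even, $\beta_i$ odd), with the variables extended to all indices $i\in\mathbb Z$ by $a_{i+n}=a_i$, $\beta_{i+n}=-\beta_i$, by the ideal generated by all $f_{j,j+m}-1$, $f_{j,j+m+1}$, $\varphi_{j,j+m+1}$, $j\in\mathbb Z$. Then the space of superfriezes of width $m$ is the affine algebraic supervariety with algebra of functions the finitely generated supercommutative algebra $\mathcal A$: the classes of the $a_i,\beta_i$ form a superfrieze over $\mathcal A$, and for every supercommutative $K$-algebra $R$, every superfrieze of width $m$ over $R$ is the image of this one under a unique parity preserving $K$-algebra homomorphism $\mathcal A\to R$. Moreover, this supervariety has dimension $m|m+1$, that is: the Krull dimension of the even part $\mathcal A_{\bar 0}$ is $m$, and $m+1$ is the greatest $s$ for which there are odd elements $y_1,\dots,y_s\in\mathcal A_{\bar 1}$ such that the Krull dimension of $\mathcal A_{\bar 0}/\mathrm{Ann}_{\mathcal A_{\bar 0}}(y_1\cdots y_s)$ equals that of $\mathcal A_{\bar 0}$. -/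

import Mathlib

universe u v

/-! ### Supercommutative algebras and affine supervarieties -/

/-- A `ℤ/2`-graded `K`-algebra, with even part `𝒜 0` and odd part `𝒜 1`, is supercommutative if
even elements are central, odd elements anticommute, and odd elements square to zero (the last
condition follows from the second one when `2` is invertible). -/
class IsSupercommutative {K : Type u} {A : Type v} [CommRing K] [Ring A] [Algebra K A]
    (𝒜 : ZMod 2 → Submodule K A) : Prop where
  even_comm : ∀ x ∈ 𝒜 0, ∀ y : A, x * y = y * x
  odd_anticomm : ∀ x ∈ 𝒜 1, ∀ y ∈ 𝒜 1, x * y = -(y * x)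
  odd_sq : ∀ x ∈ 𝒜 1, x * x = 0

/-- An affine algebraic supervariety over a field `K`, given by its superalgebra of regular
functions: a finitely generated supercommutative `K`-superalgebra. -/
structure AffineSupervariety (K : Type u) [Field K] where
  /-- the algebra of regular functions -/
  coord : Type u
  [ring : Ring coord]
  [algebra : Algebra K coord]
  /-- its even part `grading 0` and its odd part `grading 1` -/
  grading : ZMod 2 → Submodule K coord
  [graded : GradedAlgebra grading]
  [supercomm : IsSupercommutative grading]
  [finiteType : Algebra.FiniteType K coord]

namespace AffineSupervariety

attribute [instance] ring algebra graded supercomm finiteType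

variable {K : Type u} [Field K] (V : AffineSupervariety K)

/-- The even part of the algebra of regular functions. -/
abbrev Even : Type u := V.grading 0

/-- The even part is a commutative ring (with the operations of the ambient algebra). -/
noncomputable instance : CommRing V.Even :=
  { (inferInstance : Ring V.Even) with
    mul_comm := fun x _ => Subtype.ext (IsSupercommutative.even_comm _ x.2 _) }

/-- The annihilator of a regular function `y` in the even part. -/
def evenAnnihilator (y : V.coord) : Ideal V.Even where
  carrier := {r | (r : V.coord) * y = 0}
  zero_mem' := by simp
  add_mem' := by
    intro r s hr hs
    simp only [Set.mem_ofPred_eq] at hr hs ⊢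
    rw [show ((r + s : V.Even) : V.coord) = (r : V.coord) + s from rfl, add_mul, hr, hs, add_zero]
  smul_mem' := by
    intro c r hr
    simp only [Set.mem_ofPred_eq] at hr ⊢
    rw [show ((c • r : V.Even) : V.coord) = (c : V.coord) * r from rfl, mul_assoc, hr, mul_zero]

/-- Odd functions `y₁, …, yₛ` form a system of odd parameters if the annihilator of the product
`y₁ ⋯ yₛ` in the even part `A₀` defines a closed subset of full dimension:
`dim A₀ / Ann(y₁ ⋯ yₛ) = dim A₀` (Krull dimensions). -/
def IsSystemOfOddParameters {s : ℕ} (y : Fin s → V.coord) : Prop :=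
  (∀ k, y k ∈ V.grading 1) ∧
    ringKrullDim (V.Even ⧸ V.evenAnnihilator (List.ofFn y).prod) = ringKrullDim V.Even

/-- `V` has (Krull) superdimension `p|q`: the even part of its algebra of functions has Krull
dimension `p`, and `q` is the greatest length of a system of odd parameters. -/
def HasSuperdimension (p q : ℕ) : Prop :=
  ringKrullDim V.Even = (p : WithBot ℕ∞) ∧
    IsGreatest {s : ℕ | ∃ y : Fin s → V.coord, V.IsSystemOfOddParameters y} q

end AffineSupervariety

/-! ### Supersymmetric Hill equations and superfriezes -/

section Frieze

variable {R : Type v} [Ring R]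

/-- The matrix `A_i` of the supersymmetric discrete Sturm-Liouville equation
`V_i = a_i V_{i-1} - V_{i-2} - β_i W_{i-1}`, `W_i = W_{i-1} + β_i V_{i-1}`. -/
def hillMatrix (a b : ℤ → R) (i : ℤ) : Matrix (Fin 3) (Fin 3) R :=
  !![0, 1, 0;
     -1, a i, -b i;
     0, b i, 1]

/-- The vector `(f_{j,i-1}, f_{j,i}, φ_{j,i})` for `i = j - 2 + k`, along the `j`-th South-East
diagonal of the superfrieze with first rows `φ_{i,i} = β_i` and `f_{i,i} = a_i`. -/
def friezeVec (a b : ℤ → R) (j : ℤ) : ℕ → Fin 3 → R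
  | 0 => ![-1, 0, 0]
  | k + 1 => (hillMatrix a b (j - 1 + k)).mulVec (friezeVec a b j k)

/-- The even entry `f_{j,i}`, for `j - 2 ≤ i`. -/
def friezeEven (a b : ℤ → R) (j i : ℤ) : R := friezeVec a b j (i - j + 2).toNat 1

/-- The odd entry `φ_{j,i}` with integer indices, for `j - 2 ≤ i`. -/
def friezeOdd (a b : ℤ → R) (j i : ℤ) : R := friezeVec a b j (i - j + 2).toNat 2

/-- The superfriezes of width `m` over a supercommutative algebra, given by their first two
nontrivial rows `β` (odd) and `a` (even): with `n = m + 3`, the rows are (anti)periodic and the last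
three rows of the superfrieze consist of `1`s and `0`s. -/
structure IsSuperfrieze {K : Type u} [CommRing K] [Algebra K R] (𝒜 : ZMod 2 → Submodule K R)
    (m : ℕ) (a b : ℤ → R) : Prop where
  even_mem : ∀ i, a i ∈ 𝒜 0
  odd_mem : ∀ i, b i ∈ 𝒜 1
  periodic : ∀ i, a (i + (m + 3)) = a i
  antiperiodic : ∀ i, b (i + (m + 3)) = -b i
  row_one : ∀ j, friezeEven a b j (j + m) = 1
  row_zero_odd : ∀ j, friezeOdd a b j (j + m + 1) = 0
  row_zero_even : ∀ j, friezeEven a b j (j + m + 1) = 0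

end Frieze

/-! ### Generalities on `ℤ/2`-gradings -/

section Super

variable {K : Type u} {A : Type v} [CommRing K] [Ring A] [Algebra K A]

theorem univ_zmod_two : (Set.univ : Set (ZMod 2)) = {0, 1} := by
  have : ∀ x : ZMod 2, x = 0 ∨ x = 1 := by decide
  ext x
  simpa using this x

/-- A `ℤ/2`-graded monoid of submodules with complementary even and odd parts is a grading. -/
noncomputable abbrev gradedOfIsCompl (𝒜 : ZMod 2 → Submodule K A) [SetLike.GradedMonoid 𝒜]
    (h : IsCompl (𝒜 0) (𝒜 1)) : GradedAlgebra 𝒜 :=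
  { (DirectSum.IsInternal.chooseDecomposition 𝒜
      ((DirectSum.isInternal_submodule_iff_isCompl 𝒜 (i := 0) (j := 1) zero_ne_one univ_zmod_two).2 h)) with
    one_mem := SetLike.GradedOne.one_mem
    mul_mem := SetLike.GradedMul.mul_mem }

variable (𝒜 : ZMod 2 → Submodule K A) [GradedAlgebra 𝒜]

theorem exists_even_add_odd (x : A) : ∃ y ∈ 𝒜 0, ∃ z ∈ 𝒜 1, y + z = x := by
  have h : IsCompl (𝒜 0) (𝒜 1) :=
    (DirectSum.Decomposition.isInternal 𝒜).isCompl zero_ne_one univ_zmod_two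
  have hx : x ∈ 𝒜 0 ⊔ 𝒜 1 := by rw [h.sup_eq_top]; trivial
  exact Submodule.mem_sup.1 hx

theorem isTwoSided_span [IsSupercommutative 𝒜] (s : Set A)
    (hs : ∀ x ∈ s, SetLike.IsHomogeneousElem 𝒜 x) : (Ideal.span s).IsTwoSided := by
  refine ⟨fun {x} c hx => ?_⟩
  induction hx using Submodule.span_induction with
  | zero => simp
  | add x y _ _ hx hy => rw [add_mul]; exact add_mem hx hy
  | smul r x _ hx => rw [smul_eq_mul, mul_assoc]; exact Ideal.mul_mem_left _ r hx
  | mem x hxs =>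
    have hx : x ∈ Ideal.span s := Ideal.subset_span hxs
    obtain ⟨c₀, h₀, c₁, h₁, rfl⟩ := exists_even_add_odd 𝒜 c
    obtain ⟨i, hi⟩ := hs x hxs
    rw [mul_add, ← IsSupercommutative.even_comm (𝒜 := 𝒜) c₀ h₀ x]
    refine add_mem (Ideal.mul_mem_left _ _ hx) ?_
    fin_cases i
    · rw [IsSupercommutative.even_comm (𝒜 := 𝒜) x hi]
      exact Ideal.mul_mem_left _ _ hx
    · rw [IsSupercommutative.odd_anticomm (𝒜 := 𝒜) x hi c₁ h₁]
      exact neg_mem (Ideal.mul_mem_left _ _ hx)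

variable (I : Ideal A) [I.IsTwoSided]

/-- The grading of a quotient algebra by the images of the even and the odd part. -/
def quotientGrading (i : ZMod 2) : Submodule K (A ⧸ I) :=
  (𝒜 i).map (Ideal.Quotient.mkₐ K I).toLinearMap

instance quotientGrading.gradedMonoid : SetLike.GradedMonoid (quotientGrading 𝒜 I) where
  one_mem := ⟨1, SetLike.GradedOne.one_mem, map_one (Ideal.Quotient.mkₐ K I)⟩
  mul_mem := by
    rintro i j _ _ ⟨x, hx, rfl⟩ ⟨y, hy, rfl⟩
    exact ⟨x * y, SetLike.GradedMul.mul_mem hx hy, map_mul (Ideal.Quotient.mkₐ K I) x y⟩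

instance quotientGrading.supercommutative [IsSupercommutative 𝒜] :
    IsSupercommutative (quotientGrading 𝒜 I) where
  even_comm := by
    rintro _ ⟨x, hx, rfl⟩ y
    obtain ⟨y, rfl⟩ := Ideal.Quotient.mk_surjective y
    exact congrArg (Ideal.Quotient.mk I) (IsSupercommutative.even_comm (𝒜 := 𝒜) x hx y)
  odd_anticomm := by
    rintro _ ⟨x, hx, rfl⟩ _ ⟨y, hy, rfl⟩
    exact congrArg (Ideal.Quotient.mk I) (IsSupercommutative.odd_anticomm (𝒜 := 𝒜) x hx y hy)
  odd_sq := by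
    rintro _ ⟨x, hx, rfl⟩
    exact congrArg (Ideal.Quotient.mk I) (IsSupercommutative.odd_sq (𝒜 := 𝒜) x hx)

theorem quotientGrading.isCompl (hI : I.IsHomogeneous 𝒜) :
    IsCompl (quotientGrading 𝒜 I 0) (quotientGrading 𝒜 I 1) := by
  constructor
  · rw [Submodule.disjoint_def]
    rintro _ ⟨x, hx, rfl⟩ ⟨y, hy, hxy⟩
    have h : y - x ∈ I := Ideal.Quotient.eq.1 hxy
    have h0 := hI 0 h
    rw [DirectSum.decompose_sub, DirectSum.sub_apply, AddSubgroupClass.coe_sub,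
      DirectSum.decompose_of_mem_same 𝒜 hx,
      DirectSum.decompose_of_mem_ne 𝒜 hy (one_ne_zero : (1 : ZMod 2) ≠ 0), zero_sub] at h0
    exact Ideal.Quotient.eq_zero_iff_mem.2 (neg_mem_iff.1 h0)
  · rw [codisjoint_iff, Submodule.eq_top_iff']
    intro x
    obtain ⟨x, rfl⟩ := Ideal.Quotient.mk_surjective x
    obtain ⟨y, hy, z, hz, rfl⟩ := exists_even_add_odd 𝒜 x
    rw [map_add]
    exact Submodule.add_mem_sup ⟨y, hy, rfl⟩ ⟨z, hz, rfl⟩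

/-- The entries of a superfrieze have the expected parity. -/
theorem friezeVec_mem {a b : ℤ → A} (ha : ∀ i, a i ∈ 𝒜 0) (hb : ∀ i, b i ∈ 𝒜 1) (j : ℤ) (k : ℕ) :
    friezeVec a b j k 0 ∈ 𝒜 0 ∧ friezeVec a b j k 1 ∈ 𝒜 0 ∧ friezeVec a b j k 2 ∈ 𝒜 1 := by
  induction k with
  | zero =>
    refine ⟨?_, ?_, ?_⟩ <;> simp [friezeVec]
    exact SetLike.GradedOne.one_mem
  | succ k ih =>
    obtain ⟨h0, h1, h2⟩ := ih
    have e01 : (0 : ZMod 2) + 0 = 0 := rfl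
    have e11 : (1 : ZMod 2) + 1 = 0 := rfl
    have e10 : (1 : ZMod 2) + 0 = 1 := rfl
    have m1 := SetLike.GradedMul.mul_mem (ha (j - 1 + k)) h1
    have m2 := SetLike.GradedMul.mul_mem (hb (j - 1 + k)) h2
    have m3 := SetLike.GradedMul.mul_mem (hb (j - 1 + k)) h1
    rw [e01] at m1
    rw [e11] at m2
    rw [e10] at m3
    refine ⟨?_, ?_, ?_⟩
    · simpa [friezeVec, hillMatrix, Matrix.mulVec, dotProduct, Fin.sum_univ_three] using h1
    · simpa [friezeVec, hillMatrix, Matrix.mulVec, dotProduct, Fin.sum_univ_three] using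
        add_mem (add_mem (neg_mem h0) m1) (neg_mem m2)
    · simpa [friezeVec, hillMatrix, Matrix.mulVec, dotProduct, Fin.sum_univ_three] using
        add_mem m3 h2

end Super

/-! ### Polynomial superalgebras -/

section Poly

variable (K : Type u) [Field K] (n : ℕ)

/-- The polynomial superalgebra `K[a_k | β_k]` in `n` even and `n` odd variables, both indexed by
residue classes modulo `n`: the exterior algebra of a free module of rank `n` over the polynomial
ring in `n` variables. -/
abbrev PolySuper : Type u :=
  ExteriorAlgebra (MvPolynomial (ZMod n) K) (ZMod n → MvPolynomial (ZMod n) K)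

/-- The even and the odd part of the polynomial superalgebra. -/
noncomputable def polyGrading (i : ZMod 2) : Submodule K (PolySuper K n) :=
  (CliffordAlgebra.evenOdd
    (0 : QuadraticForm (MvPolynomial (ZMod n) K) (ZMod n → MvPolynomial (ZMod n) K)) i).restrictScalars
    K

instance polyGrading.gradedMonoid : SetLike.GradedMonoid (polyGrading K n) where
  one_mem := SetLike.GradedOne.one_mem (A := CliffordAlgebra.evenOdd
    (0 : QuadraticForm (MvPolynomial (ZMod n) K) (ZMod n → MvPolynomial (ZMod n) K)))
  mul_mem _ _ _ _ hx hy := SetLike.GradedMul.mul_mem (A := CliffordAlgebra.evenOdd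
    (0 : QuadraticForm (MvPolynomial (ZMod n) K) (ZMod n → MvPolynomial (ZMod n) K))) hx hy

noncomputable instance polyGrading.gradedAlgebra : GradedAlgebra (polyGrading K n) :=
  gradedOfIsCompl _ (by
    have h := CliffordAlgebra.evenOdd_isCompl
      (0 : QuadraticForm (MvPolynomial (ZMod n) K) (ZMod n → MvPolynomial (ZMod n) K))
    constructor
    · rw [Submodule.disjoint_def]
      intro x hx hy
      exact Submodule.disjoint_def.1 h.1 x hx hy
    · rw [codisjoint_iff, Submodule.eq_top_iff']
      intro x
      obtain ⟨y, hy, z, hz, rfl⟩ := Submodule.mem_sup.1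
        ((codisjoint_iff.1 h.2 ▸ Submodule.mem_top :
          x ∈ CliffordAlgebra.evenOdd _ 0 ⊔ CliffordAlgebra.evenOdd _ 1))
      exact Submodule.add_mem_sup hy hz)

section Ext

variable {P : Type u} {M : Type v} [CommRing P] [AddCommGroup M] [Module P M]

local notation "ev" => CliffordAlgebra.evenOdd (0 : QuadraticForm P M)

theorem exterior_ι_anticomm (v w : M) :
    ExteriorAlgebra.ι P v * ExteriorAlgebra.ι P w
      = -(ExteriorAlgebra.ι P w * ExteriorAlgebra.ι P v) :=
  eq_neg_of_add_eq_zero_left (ExteriorAlgebra.ι_add_mul_swap v w)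

theorem exterior_even_comm (x : ExteriorAlgebra P M) (hx : x ∈ ev 0) (y : ExteriorAlgebra P M) :
    x * y = y * x := by
  have key : ∀ v : M, x * ExteriorAlgebra.ι P v = ExteriorAlgebra.ι P v * x := by
    intro v
    induction x, hx using CliffordAlgebra.even_induction with
    | algebraMap r => exact Algebra.commutes r _
    | add x y _ _ hx hy => rw [add_mul, mul_add, hx, hy]
    | ι_mul_ι_mul m₁ m₂ x _ hx =>
      rw [mul_assoc, hx, ← mul_assoc, ← mul_assoc]
      congr 1
      rw [mul_assoc, exterior_ι_anticomm m₂ v, mul_neg, ← mul_assoc, exterior_ι_anticomm m₁ v,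
        neg_mul, neg_neg, mul_assoc]
  induction y using ExteriorAlgebra.induction with
  | algebraMap r => exact (Algebra.commutes r _).symm
  | ι v => exact key v
  | mul a b ha hb => rw [← mul_assoc, ha, mul_assoc, hb, mul_assoc]
  | add a b ha hb => rw [mul_add, add_mul, ha, hb]

theorem exterior_ι_mul_ι_mem (v w : M) :
    ExteriorAlgebra.ι P v * ExteriorAlgebra.ι P w ∈ ev 0 :=
  CliffordAlgebra.ι_mul_ι_mem_evenOdd_zero _ v w

theorem exterior_odd_anticomm (x : ExteriorAlgebra P M) (hx : x ∈ ev 1)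
    (y : ExteriorAlgebra P M) (hy : y ∈ ev 1) : x * y = -(y * x) := by
  induction x, hx using CliffordAlgebra.odd_induction with
  | ι v =>
    induction y, hy using CliffordAlgebra.odd_induction with
    | ι w => exact exterior_ι_anticomm v w
    | add y z _ _ hy hz => rw [mul_add, add_mul, hy, hz, neg_add]
    | ι_mul_ι_mul m₁ m₂ y _ hy =>
      rw [← mul_assoc, ← exterior_even_comm _ (exterior_ι_mul_ι_mem m₁ m₂), mul_assoc, hy,
        mul_neg, ← mul_assoc]
  | add x z _ _ hx hz => rw [mul_add, add_mul, hx, hz, neg_add]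
  | ι_mul_ι_mul m₁ m₂ x _ hx =>
    rw [mul_assoc, hx, mul_neg, ← mul_assoc, exterior_even_comm _ (exterior_ι_mul_ι_mem m₁ m₂) y,
      mul_assoc]

theorem exterior_odd_sq (x : ExteriorAlgebra P M) (hx : x ∈ ev 1) : x * x = 0 := by
  induction x, hx using CliffordAlgebra.odd_induction with
  | ι v => exact ExteriorAlgebra.ι_sq_zero v
  | add x y hx' hy' hx hy =>
    rw [mul_add, add_mul, add_mul, hx, hy, exterior_odd_anticomm x hx' y hy']
    simp
  | ι_mul_ι_mul m₁ m₂ x _ hx =>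
    rw [mul_assoc, ← mul_assoc x, ← exterior_even_comm _ (exterior_ι_mul_ι_mem m₁ m₂) x,
      mul_assoc _ x x, hx, mul_zero, mul_zero]

end Ext

instance polyGrading.supercommutative : IsSupercommutative (polyGrading K n) where
  even_comm x hx y := exterior_even_comm x hx y
  odd_anticomm x hx y hy := exterior_odd_anticomm x hx y hy
  odd_sq x hx := exterior_odd_sq x hx

instance polySuper_finiteType [NeZero n] : Algebra.FiniteType K (PolySuper K n) := by
  refine Algebra.FiniteType.trans (S := MvPolynomial (ZMod n) K) inferInstance ⟨?_⟩
  refine Subalgebra.fg_def.2 ⟨Set.range fun k : ZMod n =>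
    ExteriorAlgebra.ι (MvPolynomial (ZMod n) K) (Pi.single k 1), Set.finite_range _, ?_⟩
  rw [eq_top_iff]
  rintro x -
  induction x using ExteriorAlgebra.induction with
  | algebraMap r => exact Subalgebra.algebraMap_mem _ r
  | ι v =>
    have hv : v = ∑ k, v k • (Pi.single k 1 : ZMod n → MvPolynomial (ZMod n) K) := by
      ext l
      simp [Finset.sum_apply, Pi.single_apply]
    rw [hv, map_sum]
    refine sum_mem fun k _ => ?_
    rw [map_smul]
    exact Subalgebra.smul_mem _ (Algebra.subset_adjoin (Set.mem_range_self k)) _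
  | mul a b ha hb => exact mul_mem ha hb
  | add a b ha hb => exact add_mem ha hb

/-- The even variables `a_1, …, a_n`, extended to all indices by `a_{i+n} = a_i`. -/
noncomputable def polyA (i : ℤ) : PolySuper K n :=
  algebraMap (MvPolynomial (ZMod n) K) _ (MvPolynomial.X (i : ZMod n))

/-- The odd variables `β_1, …, β_n`, extended to all indices by `β_{i+n} = -β_i`. -/
noncomputable def polyB (i : ℤ) : PolySuper K n :=
  ((i - 1) / (n : ℤ)).negOnePow •
    ExteriorAlgebra.ι (MvPolynomial (ZMod n) K) (Pi.single (i : ZMod n) 1)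

theorem polyA_mem (i : ℤ) : polyA K n i ∈ polyGrading K n 0 :=
  SetLike.algebraMap_mem_graded (CliffordAlgebra.evenOdd
    (0 : QuadraticForm (MvPolynomial (ZMod n) K) (ZMod n → MvPolynomial (ZMod n) K))) _

theorem polyB_mem (i : ℤ) : polyB K n i ∈ polyGrading K n 1 := by
  have h : ExteriorAlgebra.ι (MvPolynomial (ZMod n) K) (Pi.single (i : ZMod n) 1)
      ∈ polyGrading K n 1 := CliffordAlgebra.ι_mem_evenOdd_one _ _
  unfold polyB
  rcases Int.units_eq_one_or ((i - 1) / (n : ℤ)).negOnePow with e | e <;> rw [e]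
  · simpa using h
  · rw [Units.neg_smul, one_smul]
    exact neg_mem h

end Poly

/-! ### The supervariety of superfriezes -/

section Variety

variable (K : Type u) [Field K] (m : ℕ)

/-- The polynomials `f_{j,j+m} - 1`, `f_{j,j+m+1}`, `φ_{j,j+m+1}` in the variables `a_i`, `β_i`. -/
def superfriezeRelations : Set (PolySuper K (m + 3)) :=
  {x | ∃ j : ℤ,
    x = friezeEven (polyA K (m + 3)) (polyB K (m + 3)) j (j + m) - 1 ∨
    x = friezeEven (polyA K (m + 3)) (polyB K (m + 3)) j (j + m + 1) ∨
    x = friezeOdd (polyA K (m + 3)) (polyB K (m + 3)) j (j + m + 1)}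

theorem superfriezeRelations_homogeneous (x : PolySuper K (m + 3))
    (hx : x ∈ superfriezeRelations K m) :
    SetLike.IsHomogeneousElem (polyGrading K (m + 3)) x := by
  have h := friezeVec_mem (polyGrading K (m + 3)) (polyA_mem K (m + 3)) (polyB_mem K (m + 3))
  obtain ⟨j, rfl | rfl | rfl⟩ := hx
  · exact ⟨0, sub_mem (h _ _).2.1 SetLike.GradedOne.one_mem⟩
  · exact ⟨0, (h _ _).2.1⟩
  · exact ⟨1, (h _ _).2.2⟩

/-- The ideal generated by the relations. -/
noncomputable def superfriezeIdeal : Ideal (PolySuper K (m + 3)) := Ideal.span (superfriezeRelations K m)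

instance superfriezeIdeal_isTwoSided : (superfriezeIdeal K m).IsTwoSided :=
  isTwoSided_span (polyGrading K (m + 3)) _ (superfriezeRelations_homogeneous K m)

noncomputable instance superfriezeGrading.gradedAlgebra :
    GradedAlgebra (quotientGrading (polyGrading K (m + 3)) (superfriezeIdeal K m)) :=
  gradedOfIsCompl _ (quotientGrading.isCompl _ _
    (Ideal.homogeneous_span _ _ (superfriezeRelations_homogeneous K m)))

/-- The algebraic supervariety of superfriezes of width `m`: the supervariety defined by the
equations `f_{j,j+m} = 1`, `f_{j,j+m+1} = 0`, `φ_{j,j+m+1} = 0` in the variables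
`(a_1, …, a_n, β_1, …, β_n)`, where `n = m + 3`. -/
noncomputable def superfriezeVariety : AffineSupervariety K where
  coord := PolySuper K (m + 3) ⧸ superfriezeIdeal K m
  grading := quotientGrading (polyGrading K (m + 3)) (superfriezeIdeal K m)
  finiteType := Algebra.FiniteType.of_surjective (Ideal.Quotient.mkₐ K (superfriezeIdeal K m))
    (Ideal.Quotient.mkₐ_surjective K _)

/-- The coordinate functions `a_i` on the supervariety of superfriezes. -/
noncomputable def superfriezeA (i : ℤ) : (superfriezeVariety K m).coord :=
  Ideal.Quotient.mk (superfriezeIdeal K m) (polyA K (m + 3) i)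

/-- The coordinate functions `β_i` on the supervariety of superfriezes. -/
noncomputable def superfriezeB (i : ℤ) : (superfriezeVariety K m).coord :=
  Ideal.Quotient.mk (superfriezeIdeal K m) (polyB K (m + 3) i)

end Variety

/-- `V` is the space of superfriezes of width `m`, with coordinate functions `x i`, `ξ i`: these
functions form a superfrieze over the algebra of `V`, and every superfrieze of width `m` over a
supercommutative algebra `R` is the image of that one under exactly one parity preserving
homomorphism. In other words, the `R`-points of `V` are the superfriezes of width `m` over `R`. -/
def IsSpaceOfSuperfriezes {K : Type u} [Field K] (m : ℕ) (V : AffineSupervariety K)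
    (x ξ : ℤ → V.coord) : Prop :=
  IsSuperfrieze V.grading m x ξ ∧
    ∀ (R : Type v) [Ring R] [Algebra K R] (ℛ : ZMod 2 → Submodule K R) [GradedAlgebra ℛ]
      [IsSupercommutative ℛ] (a b : ℤ → R), IsSuperfrieze ℛ m a b →
      ∃! φ : V.coord →ₐ[K] R, (∀ e, ∀ y ∈ V.grading e, φ y ∈ ℛ e) ∧
        ∀ i, φ (x i) = a i ∧ φ (ξ i) = b i

/-! The universal property is formal: even elements are central and odd elements square to zero, so
families `α`, `γ` extend to the exterior algebra over a polynomial ring, and the relations are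
exactly the conditions that define a superfrieze. The substance is the dimension.

Upper bounds. Modulo a prime of the even part every product of two odd elements vanishes, so the
quotient is a domain generated by the entries of a classical Coxeter frieze, with quiddity sequence
`c`. Such a domain has transcendence degree at most `m`: if some `c i` is nonzero, suitable `m`
consecutive entries make all the others algebraic (`trdeg_le_of_frieze`). On the odd side,
`φ_{j,j+m+1} = 0` and `f_{j,j+m} = 1` express each `β` through the preceding `m + 1`, so the odd
part is spanned by `m + 1` elements over the even part. A product of more odd elements is the image
of an alternating form of too high degree, hence zero (`prod_odd_eq_zero`).

Lower bounds. One superfrieze is built with `a_0, …, a_{m-1}` algebraically independent and `β_0, …,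
β_m` the generators of an exterior algebra over a rational function field. The superfrieze
conditions follow from the monodromy equation `A_{m+2} ⋯ A_0 = diag(-1, -1, 1)`. All factors lie in
`OSp(1|2)`, and the remaining five parameters can be solved for once the middle entry of `A_{m-1} ⋯
A_0` is invertible; its body is a continuant, a nonzero polynomial
(`exists_hillProd_eq_neg_parityMatrix`, `hillProd_X_ne_zero`). The superfrieze sends `β_0 ⋯ β_m` to
the top form, which is killed only by elements of zero body. The kernel of the body map is therefore
a prime above the annihilator of `β_0 ⋯ β_m`, with quotient of dimension at least `m`; this gives
both lower bounds (`exists_isPrime_annihilator_le`). -/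

/-! ### Krull dimension and transcendence degree. -/

/-- Incomparability gives `≤`; lying over and going up lift any chain of primes and give `≥`. -/
theorem ringKrullDim_eq_of_isIntegral {A B : Type*} [CommRing A] [CommRing B] [Algebra A B]
    [Algebra.IsIntegral A B] (h : Function.Injective (algebraMap A B)) :
    ringKrullDim B = ringKrullDim A := by
  apply le_antisymm
  · refine Order.krullDim_le_of_strictMono (PrimeSpectrum.comap (algebraMap A B)) ?_
    intro I J hIJ
    exact Ideal.IsIntegral.comap_lt_comap (I := I.asIdeal) (J := J.asIdeal) hIJ
  · refine iSup_le fun l => ?_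
    have : FaithfulSMul A B := (faithfulSMul_iff_algebraMap_injective A B).2 h
    obtain ⟨P⟩ := Ideal.nonempty_primesOver (S := B) l.head.asIdeal
    have := P.2.1
    have := P.2.2
    obtain ⟨l', hl', -⟩ := Ideal.exists_ltSeries_of_hasGoingUp l P.1
    rw [← hl']
    exact le_iSup (fun p : LTSeries (PrimeSpectrum B) => (p.length : WithBot ℕ∞)) l'

/-- Noether normalization: both invariants equal the number of variables of a polynomial ring over
which `D` is integral. -/
theorem exists_ringKrullDim_eq_trdeg_eq (K D : Type*) [Field K] [CommRing D] [IsDomain D]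
    [Algebra K D] [Algebra.FiniteType K D] :
    ∃ s : ℕ, ringKrullDim D = s ∧ Algebra.trdeg K D = s := by
  obtain ⟨s, g, hg, hint⟩ := exists_integral_inj_algHom_of_fg K D
  refine ⟨s, ?_, ?_⟩
  · algebraize [g.toRingHom]
    have : Algebra.IsIntegral (MvPolynomial (Fin s) K) D := ⟨hint⟩
    rw [ringKrullDim_eq_of_isIntegral (A := MvPolynomial (Fin s) K) hg]
    simp
  · have hai : AlgebraicIndependent K (fun i => g (MvPolynomial.X i)) := by
      rw [algebraicIndependent_iff_injective_aeval]
      convert hg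
      ext i
      simp
    have hb : IsTranscendenceBasis K (fun i => g (MvPolynomial.X i)) := by
      rw [hai.isTranscendenceBasis_iff_isAlgebraic]
      have hr : Algebra.adjoin K (Set.range fun i => g (MvPolynomial.X i)) = g.range := by
        rw [← Algebra.map_top, ← MvPolynomial.adjoin_range_X, AlgHom.map_adjoin, ← Set.range_comp]
        rfl
      rw [hr]
      refine ⟨fun x => ?_⟩
      obtain ⟨p, hp, hpx⟩ := hint x
      refine IsIntegral.isAlgebraic ?_
      refine ⟨p.map g.rangeRestrict.toRingHom, hp.map _, ?_⟩
      rw [Polynomial.eval₂_map]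
      exact hpx
    have := hb.lift_cardinalMk_eq_trdeg
    simpa using this.symm

theorem ringKrullDim_le_of_trdeg_le {K D : Type*} [Field K] [CommRing D] [IsDomain D]
    [Algebra K D] [Algebra.FiniteType K D] {m : ℕ} (h : Algebra.trdeg K D ≤ m) :
    ringKrullDim D ≤ m := by
  obtain ⟨s, h1, h2⟩ := exists_ringKrullDim_eq_trdeg_eq K D
  rw [h2] at h
  rw [h1]
  exact_mod_cast h

theorem le_ringKrullDim_of_algebraicIndependent {K D : Type*} [Field K] [CommRing D] [IsDomain D]
    [Algebra K D] [Algebra.FiniteType K D] {m : ℕ} {x : Fin m → D}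
    (h : AlgebraicIndependent K x) : (m : WithBot ℕ∞) ≤ ringKrullDim D := by
  obtain ⟨s, h1, h2⟩ := exists_ringKrullDim_eq_trdeg_eq K D
  have := h.lift_cardinalMk_le_trdeg
  rw [h2] at this
  rw [h1]
  simp only [Cardinal.mk_fin, Cardinal.lift_natCast] at this
  exact_mod_cast this

/-- A chain of primes lives in the quotient by its smallest member. This reduces the dimension bound
to domains. -/
theorem ringKrullDim_le_of_forall_isPrime {R : Type*} [CommRing R] {d : WithBot ℕ∞}
    (h : ∀ P : Ideal R, P.IsPrime → ringKrullDim (R ⧸ P) ≤ d) : ringKrullDim R ≤ d := by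
  refine iSup_le fun l => ?_
  refine le_trans ?_ (h l.head.asIdeal l.head.isPrime)
  rw [ringKrullDim_quotient]
  let l' : LTSeries (PrimeSpectrum.zeroLocus (R := R) l.head.asIdeal) :=
    { length := l.length
      toFun := fun i => ⟨l i, l.monotone (Fin.zero_le i)⟩
      step := fun i => l.step i }
  exact le_iSup (fun p : LTSeries (PrimeSpectrum.zeroLocus (R := R) l.head.asIdeal) =>
    (p.length : WithBot ℕ∞)) l'

/-! ### Classical friezes over a domain. -/

/-- Here `F j k` plays the role of `f_{j,j-2+k}` once the odd terms have vanished. The entries `c j,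
…, c (j+m-1)` determine `F j (m+1)`; the equation `F j (m+2) = 1` is linear in `c (j+m)` with that
leading coefficient, and the last two entries of a period are continuants of earlier ones. -/
theorem trdeg_le_of_frieze {K D : Type*} [Field K] [CommRing D] [IsDomain D] [Algebra K D]
    {m : ℕ} {c : ℤ → D} {F : ℤ → ℕ → D} (hc : ∀ i, c (i + (m + 3)) = c i)
    (hF0 : ∀ j, F j 0 = 0) (hF1 : ∀ j, F j 1 = 1)
    (hF : ∀ j (k : ℕ), F j (k + 2) = c (j + k) * F j (k + 1) - F j k)
    (hone : ∀ j, F j (m + 2) = 1) (hzero : ∀ j, F j (m + 3) = 0)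
    (hgen : Algebra.adjoin K (Set.range c) = ⊤) : Algebra.trdeg K D ≤ m := by
  by_cases h0 : ∀ i, c i = 0
  · have : Algebra.IsAlgebraic (Algebra.adjoin K (∅ : Set D)) D := by
      refine ⟨fun x => ?_⟩
      have hx : x ∈ Algebra.adjoin K (Set.range c) := hgen ▸ trivial
      have hx' : x ∈ Algebra.adjoin K (∅ : Set D) := by
        refine Algebra.adjoin_le ?_ hx
        rintro _ ⟨i, rfl⟩
        rw [h0 i]
        exact zero_mem _
      exact isAlgebraic_algebraMap (⟨x, hx'⟩ : Algebra.adjoin K (∅ : Set D))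
    refine (Algebra.IsAlgebraic.trdeg_le_cardinalMk K (∅ : Set D)).trans ?_
    simp
  push Not at h0
  obtain ⟨i, hi⟩ := h0
  -- The diagonal is chosen so that `F j (m+1)`, the coefficient of `c (j+m)` in `F j (m+2) = 1`, is
  -- the nonzero entry `c i`.
  obtain ⟨j, rfl⟩ : ∃ j : ℤ, j + (m + 1 : ℕ) = i := ⟨i - (m + 1 : ℕ), by ring⟩
  have hlast : ∀ j, F j (m + 1) = c (j + (m + 1 : ℕ)) := fun j => by
    have := hF j (m + 1)
    rw [hzero, hone, mul_one] at this
    linear_combination this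
  set s : Set D := Set.range fun k : Fin m => c (j + (k : ℕ)) with hs
  have hmem : ∀ k : ℕ, k < m → c (j + k) ∈ Algebra.adjoin K s := fun k hk =>
    Algebra.subset_adjoin ⟨⟨k, hk⟩, rfl⟩
  have hFmem : ∀ k : ℕ, k < m + 1 → F j k ∈ Algebra.adjoin K s ∧ F j (k + 1) ∈ Algebra.adjoin K s := by
    intro k
    induction k with
    | zero => intro _; rw [hF0, hF1]; exact ⟨zero_mem _, one_mem _⟩
    | succ k ih =>
      intro hk
      obtain ⟨h1, h2⟩ := ih (by omega)
      exact ⟨h2, by rw [hF]; exact sub_mem (mul_mem (hmem k (by omega)) h2) h1⟩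
  let C := Subalgebra.algebraicClosure (Algebra.adjoin K s) D
  have hC : ∀ x ∈ Algebra.adjoin K s, x ∈ C := fun x hx =>
    isAlgebraic_algebraMap (⟨x, hx⟩ : Algebra.adjoin K s)
  have hcm : c (j + m) ∈ C := by
    have h1 : c (j + m) * F j (m + 1) = 1 + F j m := by
      have := hF j m
      rw [hone] at this
      linear_combination -this
    have h2 : IsAlgebraic (Algebra.adjoin K s) (F j (m + 1) * c (j + m)) := by
      rw [mul_comm, h1]
      exact hC _ (add_mem (one_mem _) (hFmem m (by omega)).1)
    refine IsAlgebraic.of_smul (y := (⟨F j (m + 1), (hFmem m (by omega)).2⟩ :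
      Algebra.adjoin K s)) (mem_nonZeroDivisors_of_ne_zero fun h => hi ?_) h2
    rw [← hlast]
    exact congrArg Subtype.val h
  have hcC : ∀ k : ℕ, k < m + 1 → c (j + k) ∈ C := fun k hk => by
    rcases Nat.lt_succ_iff_lt_or_eq.1 hk with h | rfl
    · exact hC _ (hmem k h)
    · exact hcm
  have hFC : ∀ k : ℕ, k < m + 1 → F (j + 1) k ∈ C ∧ F (j + 1) (k + 1) ∈ C := by
    intro k
    induction k with
    | zero => intro _; rw [hF0, hF1]; exact ⟨zero_mem _, one_mem _⟩
    | succ k ih =>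
      intro hk
      obtain ⟨h1, h2⟩ := ih (by omega)
      refine ⟨h2, ?_⟩
      rw [hF, add_assoc, add_comm (1 : ℤ)]
      exact sub_mem (mul_mem (by exact_mod_cast hcC (k + 1) (by omega)) h2) h1
  have hall : ∀ k : ℕ, k < m + 3 → c (j + k) ∈ C := fun k hk => by
    rcases (by omega : k < m + 1 ∨ k = m + 1 ∨ k = m + 2) with h | rfl | rfl
    · exact hcC k h
    · rw [← hlast]; exact hC _ (hFmem m (by omega)).2
    -- The last entry `c (j+m+2)` is read off the next diagonal, as `F (j+1) (m+1)`.
    · have := (hFC m (by omega)).2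
      rw [hlast] at this
      convert this using 2
      push_cast; ring
  have hper : ∀ q : ℤ, ∀ i, c (i + q * (m + 3)) = c i := by
    intro q
    induction q using Int.induction_on with
    | zero => simp
    | succ q ih => intro i; rw [← ih i, ← hc (i + q * (m + 3))]; congr 1; ring
    | pred q ih => intro i; rw [← ih i, ← hc (i + (-q - 1) * (m + 3))]; congr 1; ring
  have hci : ∀ i, c i ∈ C := fun i => by
    have hpos : (0 : ℤ) < m + 3 := by positivity
    have h1 := Int.emod_nonneg (i - j) hpos.ne'
    have h2 := Int.emod_lt_of_pos (i - j) hpos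
    have h3 := Int.emod_add_mul_ediv (i - j) (m + 3)
    have h4 := hall ((i - j) % (m + 3)).toNat (by omega)
    rw [Int.toNat_of_nonneg h1, ← hper ((i - j) / (m + 3))] at h4
    convert h4 using 2
    linear_combination -h3
  have halg : Algebra.IsAlgebraic (Algebra.adjoin K s) D := by
    refine ⟨fun x => ?_⟩
    have hx : x ∈ Algebra.adjoin K (Set.range c) := hgen ▸ trivial
    have : Algebra.adjoin K (Set.range c) ≤ C.restrictScalars K := by
      refine Algebra.adjoin_le ?_
      rintro _ ⟨i, rfl⟩
      exact hci i
    exact this hx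
  refine (Algebra.IsAlgebraic.trdeg_le_cardinalMk K s).trans ?_
  have := Cardinal.mk_range_le_lift (f := fun k : Fin m => c (j + (k : ℕ)))
  rw [← hs] at this
  simpa using this

/-! ### Recurrences along a diagonal. -/

theorem friezeVec_map {R S : Type*} [Ring R] [Ring S] (φ : R →+* S) (a b : ℤ → R) (j : ℤ) (k : ℕ)
    (i : Fin 3) :
    φ (friezeVec a b j k i) = friezeVec (fun i => φ (a i)) (fun i => φ (b i)) j k i := by
  induction k generalizing i with
  | zero => fin_cases i <;> simp [friezeVec]
  | succ k ih =>
    fin_cases i <;>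
      simp [friezeVec, hillMatrix, Matrix.mulVec, dotProduct, Fin.sum_univ_three, ih]

theorem friezeVec_add_two {R : Type*} [Ring R] (a b : ℤ → R) (j : ℤ) (k : ℕ) :
    friezeVec a b j (k + 2) 1 = a (j + k) * friezeVec a b j (k + 1) 1 - friezeVec a b j k 1
      - b (j + k) * friezeVec a b j (k + 1) 2 := by
  have : j - 1 + (k + 1 : ℕ) = j + k := by push_cast; ring
  rw [friezeVec, this]
  simp [hillMatrix, Matrix.mulVec, dotProduct, Fin.sum_univ_three, friezeVec]
  abel

theorem friezeVec_odd_succ {R : Type*} [Ring R] (a b : ℤ → R) (j : ℤ) (k : ℕ) :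
    friezeVec a b j (k + 1) 2 = b (j - 1 + k) * friezeVec a b j k 1 + friezeVec a b j k 2 := by
  rw [friezeVec]
  simp [hillMatrix, Matrix.mulVec, dotProduct, Fin.sum_univ_three]

theorem friezeEven_eq_friezeVec {R : Type*} [Ring R] (a b : ℤ → R) (j : ℤ) (m : ℕ) :
    friezeEven a b j (j + m) = friezeVec a b j (m + 2) 1 := by
  unfold friezeEven; congr 1; omega

theorem friezeEven_eq_friezeVec_succ {R : Type*} [Ring R] (a b : ℤ → R) (j : ℤ) (m : ℕ) :
    friezeEven a b j (j + m + 1) = friezeVec a b j (m + 3) 1 := by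
  unfold friezeEven; congr 1; omega

theorem friezeOdd_eq_friezeVec_succ {R : Type*} [Ring R] (a b : ℤ → R) (j : ℤ) (m : ℕ) :
    friezeOdd a b j (j + m + 1) = friezeVec a b j (m + 3) 2 := by
  unfold friezeOdd; congr 1; omega

/-! ### The universal property. -/

section Lift

variable {K : Type u} [Field K] {n : ℕ} [NeZero n]

theorem polySuper_algHom_ext {R : Type*} [Ring R] [Algebra K R] {φ ψ : PolySuper K n →ₐ[K] R}
    (hX : ∀ k, φ (algebraMap (MvPolynomial (ZMod n) K) _ (MvPolynomial.X k)) =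
      ψ (algebraMap (MvPolynomial (ZMod n) K) _ (MvPolynomial.X k)))
    (hι : ∀ k, φ (ExteriorAlgebra.ι (MvPolynomial (ZMod n) K) (Pi.single k 1)) =
      ψ (ExteriorAlgebra.ι (MvPolynomial (ZMod n) K) (Pi.single k 1))) : φ = ψ := by
  have hP : ∀ p : MvPolynomial (ZMod n) K, φ (algebraMap _ _ p) = ψ (algebraMap _ _ p) := by
    intro p
    induction p using MvPolynomial.induction_on with
    | C r =>
      rw [← MvPolynomial.algebraMap_eq, ← IsScalarTower.algebraMap_apply, AlgHom.commutes,
        AlgHom.commutes]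
    | add p q hp hq => rw [map_add, map_add, map_add, hp, hq]
    | mul_X p k hp => rw [map_mul, map_mul, map_mul, hp, hX]
  ext x
  induction x using ExteriorAlgebra.induction with
  | algebraMap r => exact hP r
  | ι v =>
    have hv : v = ∑ k, v k • (Pi.single k 1 : ZMod n → MvPolynomial (ZMod n) K) := by
      ext l
      simp [Finset.sum_apply, Pi.single_apply]
    rw [hv, map_sum, map_sum, map_sum]
    refine Finset.sum_congr rfl fun k _ => ?_
    rw [map_smul, Algebra.smul_def, map_mul, map_mul, hP, hι]
  | mul a b ha hb => rw [map_mul, map_mul, ha, hb]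
  | add a b ha hb => rw [map_add, map_add, ha, hb]

theorem exists_polySuper_algHom {R : Type v} [Ring R] [Algebra K R] (ℛ : ZMod 2 → Submodule K R)
    [GradedAlgebra ℛ] [IsSupercommutative ℛ] {α γ : ZMod n → R} (hα : ∀ k, α k ∈ ℛ 0)
    (hγ : ∀ k, γ k ∈ ℛ 1) :
    ∃ φ : PolySuper K n →ₐ[K] R, (∀ e, ∀ y ∈ polyGrading K n e, φ y ∈ ℛ e) ∧
      (∀ k, φ (algebraMap (MvPolynomial (ZMod n) K) _ (MvPolynomial.X k)) = α k) ∧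
      ∀ k, φ (ExteriorAlgebra.ι (MvPolynomial (ZMod n) K) (Pi.single k 1)) = γ k := by
  have hcen : ∀ x ∈ ℛ 0, x ∈ Subalgebra.center K R := fun x hx =>
    Subalgebra.mem_center_iff.2 fun y => (IsSupercommutative.even_comm (𝒜 := ℛ) x hx y).symm
  let e : MvPolynomial (ZMod n) K →ₐ[K] R := (Subalgebra.center K R).val.comp
    (MvPolynomial.aeval fun k => (⟨α k, hcen _ (hα k)⟩ : Subalgebra.center K R))
  have heX : ∀ k, e (MvPolynomial.X k) = α k := fun k => by simp [e]
  have he : ∀ p, e p ∈ ℛ 0 := by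
    intro p
    induction p using MvPolynomial.induction_on with
    | C r =>
      rw [← MvPolynomial.algebraMap_eq, AlgHom.commutes]
      exact SetLike.algebraMap_mem_graded ℛ r
    | add p q hp hq => rw [map_add]; exact add_mem hp hq
    | mul_X p k hp =>
      rw [map_mul, heX]
      exact SetLike.mul_mem_graded (A := ℛ) hp (hα k)
  -- The even values `α k` are central, so `R` becomes an algebra over the polynomial ring and the
  -- exterior algebra can be mapped to it by its universal property.
  let : Algebra (MvPolynomial (ZMod n) K) R := e.toRingHom.toAlgebra' fun p x =>
    IsSupercommutative.even_comm (𝒜 := ℛ) _ (he p) x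
  have : IsScalarTower K (MvPolynomial (ZMod n) K) R :=
    IsScalarTower.of_algebraMap_eq fun r => (e.commutes r).symm
  have hsmul : ∀ (p : MvPolynomial (ZMod n) K) (x : R), p • x = e p * x := fun p x =>
    Algebra.smul_def p x
  let f : (ZMod n → MvPolynomial (ZMod n) K) →ₗ[MvPolynomial (ZMod n) K] R :=
    Fintype.linearCombination (MvPolynomial (ZMod n) K) γ
  have hf : ∀ v, f v ∈ ℛ 1 := fun v => by
    simp only [f, Fintype.linearCombination_apply]
    refine sum_mem fun k _ => ?_
    rw [hsmul]
    exact SetLike.mul_mem_graded (A := ℛ) (he _) (hγ k)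
  let φ := ExteriorAlgebra.lift (MvPolynomial (ZMod n) K)
    ⟨f, fun v => IsSupercommutative.odd_sq (𝒜 := ℛ) _ (hf v)⟩
  have hφι : ∀ v, φ (ExteriorAlgebra.ι _ v) = f v := fun v => ExteriorAlgebra.lift_ι_apply _ _ _ _
  have h2 : ∀ v w, ∀ (i : ZMod 2), ∀ x, φ x ∈ ℛ i →
      φ (ExteriorAlgebra.ι _ v * ExteriorAlgebra.ι _ w * x) ∈ ℛ i := by
    intro v w i x hx
    rw [map_mul, map_mul, hφι, hφι]
    have := SetLike.mul_mem_graded (A := ℛ) (SetLike.mul_mem_graded (A := ℛ) (hf v) (hf w)) hx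
    rwa [show (1 : ZMod 2) + 1 + i = i by rw [show (1 : ZMod 2) + 1 = 0 from rfl, zero_add]] at this
  refine ⟨φ.restrictScalars K, ?_, ?_, ?_⟩
  · intro i y hy
    change φ y ∈ ℛ i
    fin_cases i
    · change y ∈ CliffordAlgebra.evenOdd _ 0 at hy
      change φ y ∈ ℛ 0
      induction y, hy using CliffordAlgebra.even_induction with
      | algebraMap r => rw [AlgHom.commutes]; exact he r
      | add x y _ _ hx hy => rw [map_add]; exact add_mem hx hy
      | ι_mul_ι_mul m₁ m₂ x _ hx => exact h2 _ _ _ _ hx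
    · change y ∈ CliffordAlgebra.evenOdd _ 1 at hy
      change φ y ∈ ℛ 1
      induction y, hy using CliffordAlgebra.odd_induction with
      | ι v => exact (hφι v).symm ▸ hf v
      | add x y _ _ hx hy => rw [map_add]; exact add_mem hx hy
      | ι_mul_ι_mul m₁ m₂ x _ hx => exact h2 _ _ _ _ hx
  · intro k
    change φ (algebraMap _ _ _) = _
    rw [AlgHom.commutes]
    exact heX k
  · intro k
    change φ (ExteriorAlgebra.ι _ _) = _
    rw [hφι]
    simp [f]

end Lift

theorem periodic_zmul {R : Type*} {n : ℤ} {a : ℤ → R} (ha : ∀ i, a (i + n) = a i) (i q : ℤ) :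
    a (i + n * q) = a i := by
  induction q using Int.induction_on with
  | zero => simp
  | succ q ih => rw [← ih, ← ha (i + n * q)]; congr 1; ring
  | pred q ih => rw [← ih, ← ha (i + n * (-q - 1))]; congr 1; ring

theorem antiperiodic_zmul {R : Type*} [Ring R] {n : ℤ} {b : ℤ → R} (hb : ∀ i, b (i + n) = -b i)
    (i q : ℤ) : b (i + n * q) = q.negOnePow • b i := by
  induction q using Int.induction_on with
  | zero => simp
  | succ q ih =>
    rw [Int.negOnePow_succ, Units.neg_smul, ← ih, ← hb (i + n * q)]; congr 1; ring
  | pred q ih =>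
    have h := hb (i + n * (-q - 1))
    rw [Int.negOnePow_sub, Int.negOnePow_one, mul_neg, mul_one, Units.neg_smul, ← ih, eq_neg_iff_add_eq_zero,
      ← neg_eq_iff_add_eq_zero, ← h]
    congr 1; ring

section Poly

variable (K : Type u) [Field K] (n : ℕ)

theorem polyA_periodic (i : ℤ) : polyA K n (i + n) = polyA K n i := by
  simp [polyA]

theorem polyB_antiperiodic [NeZero n] (i : ℤ) : polyB K n (i + n) = -polyB K n i := by
  have hn : (n : ℤ) ≠ 0 := by exact_mod_cast NeZero.ne n
  have : (i + n - 1) / (n : ℤ) = (i - 1) / n + 1 := by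
    rw [show i + n - 1 = (i - 1) + n by ring, Int.add_ediv_of_dvd_right dvd_rfl, Int.ediv_self hn]
  rw [polyB, polyB, this, Int.negOnePow_succ, Units.neg_smul]
  simp

end Poly

theorem superfrieze_isSuperfrieze (K : Type u) [Field K] (m : ℕ) :
    IsSuperfrieze (superfriezeVariety K m).grading m (superfriezeA K m) (superfriezeB K m) := by
  have hmap : ∀ j k i, friezeVec (superfriezeA K m) (superfriezeB K m) j k i =
      Ideal.Quotient.mk (superfriezeIdeal K m)
        (friezeVec (polyA K (m + 3)) (polyB K (m + 3)) j k i) := fun j k i =>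
    (friezeVec_map (Ideal.Quotient.mk (superfriezeIdeal K m)) _ _ j k i).symm
  refine ⟨fun i => ⟨_, polyA_mem K _ i, rfl⟩, fun i => ⟨_, polyB_mem K _ i, rfl⟩, fun i => ?_,
    fun i => ?_, fun j => ?_, fun j => ?_, fun j => ?_⟩
  · exact congrArg (Ideal.Quotient.mk (superfriezeIdeal K m)) (polyA_periodic K (m + 3) i)
  · exact congrArg (Ideal.Quotient.mk (superfriezeIdeal K m)) (polyB_antiperiodic K (m + 3) i)
  · rw [friezeEven, hmap]
    refine (Ideal.Quotient.mk_eq_mk_iff_sub_mem _ _).2 (Ideal.subset_span ⟨j, Or.inl rfl⟩)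
  · rw [friezeOdd, hmap]
    exact Ideal.Quotient.eq_zero_iff_mem.2 (Ideal.subset_span ⟨j, Or.inr (Or.inr rfl)⟩)
  · rw [friezeEven, hmap]
    exact Ideal.Quotient.eq_zero_iff_mem.2 (Ideal.subset_span ⟨j, Or.inr (Or.inl rfl)⟩)

theorem isSpaceOfSuperfriezes (K : Type u) [Field K] (m : ℕ) :
    IsSpaceOfSuperfriezes.{u, v} m (superfriezeVariety K m) (superfriezeA K m)
      (superfriezeB K m) := by
  refine ⟨superfrieze_isSuperfrieze K m, fun R _ _ ℛ _ _ a b h => ?_⟩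
  have hn : ((m + 3 : ℕ) : ℤ) ≠ 0 := by positivity
  have hper : ∀ i q, a (i + (m + 3 : ℕ) * q) = a i := fun i q =>
    periodic_zmul (by exact_mod_cast h.periodic) i q
  have hanti : ∀ i q, b (i + (m + 3 : ℕ) * q) = q.negOnePow • b i := fun i q =>
    antiperiodic_zmul (by exact_mod_cast h.antiperiodic) i q
  -- Representatives are taken in `1, …, m+3`, the window on which the sign in `polyB` is trivial.
  let rep : ZMod (m + 3) → ℤ := fun k => ((k.cast : ℤ) - 1) % (m + 3 : ℕ) + 1
  have hrep : ∀ i : ℤ, rep (i : ZMod (m + 3)) = (i - 1) % (m + 3 : ℕ) + 1 := fun i => by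
    simp only [rep]
    congr 1
    rw [ZMod.coe_intCast, Int.emod_sub_emod]
  have hi : ∀ i : ℤ, rep (i : ZMod (m + 3)) + (m + 3 : ℕ) * ((i - 1) / (m + 3 : ℕ)) = i :=
    fun i => by
      rw [hrep]
      linear_combination Int.emod_add_mul_ediv (i - 1) (m + 3 : ℕ)
  obtain ⟨φ, hφ, hX, hι⟩ := exists_polySuper_algHom (K := K) (n := m + 3) ℛ
    (α := fun k => a (rep k)) (γ := fun k => b (rep k)) (fun k => h.even_mem _)
    (fun k => h.odd_mem _)
  have hA : ∀ i, φ (polyA K (m + 3) i) = a i := fun i => by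
    rw [polyA, hX, ← hper _ ((i - 1) / (m + 3 : ℕ)), hi]
  have hB : ∀ i, φ (polyB K (m + 3) i) = b i := fun i => by
    conv_rhs => rw [← hi i, hanti]
    rw [polyB]
    rcases Int.units_eq_one_or ((i - 1) / ((m + 3 : ℕ) : ℤ)).negOnePow with e | e <;> rw [e]
    · rw [one_smul, one_smul, hι]
    · rw [Units.neg_smul, Units.neg_smul, one_smul, one_smul, map_neg, hι]
  have hvec : ∀ j k i, φ (friezeVec (polyA K (m + 3)) (polyB K (m + 3)) j k i) =
      friezeVec a b j k i := fun j k i => by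
    have := friezeVec_map φ.toRingHom (polyA K (m + 3)) (polyB K (m + 3)) j k i
    simp only [AlgHom.toRingHom_eq_coe, RingHom.coe_coe, hA, hB] at this
    exact this
  have hker : ∀ x ∈ superfriezeIdeal K m, φ x = 0 := by
    suffices superfriezeIdeal K m ≤ RingHom.ker φ from fun x hx => this hx
    refine Ideal.span_le.2 ?_
    rintro _ ⟨j, rfl | rfl | rfl⟩
    · change φ _ = 0
      rw [map_sub, friezeEven, hvec, map_one, sub_eq_zero]
      exact h.row_one j
    · change φ _ = 0
      rw [friezeEven, hvec]
      exact h.row_zero_even j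
    · change φ _ = 0
      rw [friezeOdd, hvec]
      exact h.row_zero_odd j
  refine ⟨Ideal.Quotient.liftₐ (superfriezeIdeal K m) φ hker, ⟨?_, fun i => ⟨hA i, hB i⟩⟩, ?_⟩
  · rintro e _ ⟨x, hx, rfl⟩
    exact hφ e x hx
  · rintro ψ ⟨-, hψ⟩
    refine AlgHom.coe_ringHom_injective ?_
    refine Ideal.Quotient.ringHom_ext ?_
    have hext : ψ.comp (Ideal.Quotient.mkₐ K (superfriezeIdeal K m)) = φ := by
      refine polySuper_algHom_ext (fun k => ?_) (fun k => ?_)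
      · obtain ⟨i, rfl⟩ := ZMod.intCast_surjective k
        exact ((hψ i).1).trans (hA i).symm
      · obtain ⟨i, rfl⟩ := ZMod.intCast_surjective k
        have h1 : (ψ.comp (Ideal.Quotient.mkₐ K (superfriezeIdeal K m))) (polyB K (m + 3) i) =
          φ (polyB K (m + 3) i) := ((hψ i).2).trans (hB i).symm
        rw [polyB] at h1
        rcases Int.units_eq_one_or ((i - 1) / ((m + 3 : ℕ) : ℤ)).negOnePow with e | e <;>
          rw [e] at h1
        · rwa [one_smul] at h1
        · rwa [Units.neg_smul, one_smul, map_neg, map_neg, neg_inj] at h1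
    ext x
    exact DFunLike.congr_fun hext x

/-! ### Odd elements over the even part. -/

namespace AffineSupervariety

variable {K : Type u} [Field K] (V : AffineSupervariety K)

noncomputable instance : Algebra K V.Even :=
  { (inferInstance : Algebra K (V.grading 0)) with }

/-- The inclusion of the even part. -/
def evenVal : V.Even →ₐ[K] V.coord where
  toFun := Subtype.val
  map_one' := rfl
  map_mul' _ _ := rfl
  map_zero' := rfl
  map_add' _ _ := rfl
  commutes' _ := rfl

noncomputable instance : Algebra V.Even V.coord :=
  V.evenVal.toRingHom.toAlgebra' fun x y =>
    IsSupercommutative.even_comm (𝒜 := V.grading) x.1 x.2 y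

theorem odd_mul_odd_mem {y z : V.coord} (hy : y ∈ V.grading 1) (hz : z ∈ V.grading 1) :
    y * z ∈ V.grading 0 :=
  SetLike.mul_mem_graded (A := V.grading) hy hz

theorem even_mul_mem {x y : V.coord} {i : ZMod 2} (hx : x ∈ V.grading 0) (hy : y ∈ V.grading i) :
    x * y ∈ V.grading i := by
  have := SetLike.mul_mem_graded (A := V.grading) hx hy
  rwa [zero_add] at this

/-- The square of `y * z` is zero because `y` and `z` anticommute and square to zero. -/
theorem odd_mul_odd_mem_of_isPrime (P : Ideal V.Even) [P.IsPrime] {y z : V.coord}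
    (hy : y ∈ V.grading 1) (hz : z ∈ V.grading 1) :
    (⟨y * z, V.odd_mul_odd_mem hy hz⟩ : V.Even) ∈ P := by
  refine Ideal.IsPrime.mem_of_pow_mem ‹P.IsPrime› 2 ?_
  convert P.zero_mem
  refine Subtype.ext ?_
  rw [pow_two]
  change y * z * (y * z) = 0
  rw [mul_assoc, ← mul_assoc z y z, IsSupercommutative.odd_anticomm (𝒜 := V.grading) z hz y hy,
    neg_mul, mul_assoc y z z, IsSupercommutative.odd_sq (𝒜 := V.grading) z hz, mul_zero, neg_zero,
    mul_zero]

/-- The exterior algebra on `q` generators over the even part maps onto a subalgebra containing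
every `y k`, and the product lifts to degree `s`. An alternating map is determined by injective
families of basis vectors, and there are none when `q < s`. -/
theorem prod_odd_eq_zero {q s : ℕ} (hqs : q < s) {g : Fin q → V.coord}
    (hg : ∀ k, g k ∈ V.grading 1)
    (hspan : ∀ y ∈ V.grading 1, y ∈ Submodule.span V.Even (Set.range g)) {y : Fin s → V.coord}
    (hy : ∀ k, y k ∈ V.grading 1) : (List.ofFn y).prod = 0 := by
  let f : (Fin q → V.Even) →ₗ[V.Even] V.coord := Fintype.linearCombination V.Even g
  have hf : ∀ v, f v ∈ V.grading 1 := fun v => by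
    simp only [f, Fintype.linearCombination_apply]
    exact sum_mem fun k _ => V.even_mul_mem (v k).2 (hg k)
  let φ := ExteriorAlgebra.lift V.Even
    ⟨f, fun v => IsSupercommutative.odd_sq (𝒜 := V.grading) _ (hf v)⟩
  have hφι : ∀ v, φ (ExteriorAlgebra.ι _ v) = f v := fun v => ExteriorAlgebra.lift_ι_apply _ _ _ _
  choose v hv using fun k => (Submodule.mem_span_range_iff_exists_fun V.Even).1 (hspan _ (hy k))
  have hfv : ∀ k, f (v k) = y k := hv
  have h0 : ExteriorAlgebra.ιMulti V.Even s (M := Fin q → V.Even) = 0 :=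
    Module.Basis.ext_alternating (Pi.basisFun V.Even (Fin q)) fun w hw => by
      have := Fintype.card_le_of_injective w hw
      simp only [Fintype.card_fin] at this
      omega
  have := congrArg φ (DFunLike.congr_fun h0 v)
  rw [ExteriorAlgebra.ιMulti_apply, map_list_prod, List.map_ofFn, AlternatingMap.zero_apply,
    map_zero] at this
  rwa [show φ ∘ (fun k => ExteriorAlgebra.ι V.Even (v k)) = y from
    funext fun k => (hφι (v k)).trans (hfv k)] at this

end AffineSupervariety

/-! ### Upper bounds for the superdimension. -/

section

variable (K : Type u) [Field K] (m : ℕ)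

theorem superfriezeVec_mem (j : ℤ) (k : ℕ) :
    friezeVec (superfriezeA K m) (superfriezeB K m) j k 0 ∈ (superfriezeVariety K m).grading 0 ∧
    friezeVec (superfriezeA K m) (superfriezeB K m) j k 1 ∈ (superfriezeVariety K m).grading 0 ∧
    friezeVec (superfriezeA K m) (superfriezeB K m) j k 2 ∈ (superfriezeVariety K m).grading 1 :=
  friezeVec_mem _ (superfrieze_isSuperfrieze K m).even_mem (superfrieze_isSuperfrieze K m).odd_mem
    j k

/-- An even element is a polynomial in the `a_i` plus terms containing a product of two odd
elements, and these terms lie in `P`. -/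
theorem even_mk_mem_adjoin (P : Ideal (superfriezeVariety K m).Even) [P.IsPrime]
    (x : PolySuper K (m + 3)) (hx : x ∈ polyGrading K (m + 3) 0) :
    Ideal.Quotient.mk P ⟨Ideal.Quotient.mk (superfriezeIdeal K m) x, ⟨x, hx, rfl⟩⟩ ∈
      Algebra.adjoin K (Set.range fun i : ℤ => Ideal.Quotient.mk P
        ⟨superfriezeA K m i, (superfrieze_isSuperfrieze K m).even_mem i⟩) := by
  set S := Algebra.adjoin K (Set.range fun i : ℤ => Ideal.Quotient.mk P
        ⟨superfriezeA K m i, (superfrieze_isSuperfrieze K m).even_mem i⟩)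
  have hP : ∀ p : MvPolynomial (ZMod (m + 3)) K, ∀ hp : Ideal.Quotient.mk (superfriezeIdeal K m)
      (algebraMap _ _ p) ∈ (superfriezeVariety K m).grading 0,
      Ideal.Quotient.mk P ⟨Ideal.Quotient.mk (superfriezeIdeal K m) (algebraMap _ _ p), hp⟩ ∈ S := by
    intro p
    have hmem : ∀ p : MvPolynomial (ZMod (m + 3)) K, Ideal.Quotient.mk (superfriezeIdeal K m)
        (algebraMap _ _ p) ∈ (superfriezeVariety K m).grading 0 := fun p =>
      ⟨_, SetLike.algebraMap_mem_graded (CliffordAlgebra.evenOdd _) p, rfl⟩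
    induction p using MvPolynomial.induction_on with
    | C r => intro hp; exact S.algebraMap_mem r
    | add p q hp hq =>
      intro _
      refine cast (congrArg (· ∈ S) ?_) (add_mem (hp (hmem p)) (hq (hmem q)))
      rw [← map_add]
      exact congrArg _ (Subtype.ext (map_add ((Ideal.Quotient.mk (superfriezeIdeal K m)).comp
        (algebraMap _ _)) p q).symm)
    | mul_X p k hp =>
      intro _
      obtain ⟨i, rfl⟩ := ZMod.intCast_surjective k
      refine cast (congrArg (· ∈ S) ?_)
        (mul_mem (hp (hmem p)) (Algebra.subset_adjoin (Set.mem_range_self i)))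
      rw [← map_mul]
      exact congrArg _ (Subtype.ext (map_mul ((Ideal.Quotient.mk (superfriezeIdeal K m)).comp
        (algebraMap _ _)) p (MvPolynomial.X i)).symm)
  suffices ∀ hx' : Ideal.Quotient.mk (superfriezeIdeal K m) x ∈ (superfriezeVariety K m).grading 0,
    Ideal.Quotient.mk P ⟨Ideal.Quotient.mk (superfriezeIdeal K m) x, hx'⟩ ∈ S from this _
  change x ∈ CliffordAlgebra.evenOdd _ 0 at hx
  induction x, hx using CliffordAlgebra.even_induction with
  | algebraMap r => exact hP r
  | add x y hx hy ihx ihy =>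
    intro _
    refine cast (congrArg (· ∈ S) ?_) (add_mem (ihx ⟨x, hx, rfl⟩) (ihy ⟨y, hy, rfl⟩))
    rw [← map_add]
    exact congrArg _ (Subtype.ext (map_add (Ideal.Quotient.mk (superfriezeIdeal K m)) x y).symm)
  | ι_mul_ι_mul v w x hx ihx =>
    intro _
    have hι : ∀ v, Ideal.Quotient.mk (superfriezeIdeal K m) (CliffordAlgebra.ι _ v) ∈
        (superfriezeVariety K m).grading 1 := fun v =>
      ⟨_, CliffordAlgebra.ι_mem_evenOdd_one _ v, rfl⟩
    have h := (superfriezeVariety K m).odd_mul_odd_mem_of_isPrime P (hι v) (hι w)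
    refine cast (congrArg (· ∈ S) ?_) (zero_mem S)
    symm
    refine Ideal.Quotient.eq_zero_iff_mem.2 ?_
    refine cast (congrArg (· ∈ P) ?_) (P.mul_mem_right ⟨_, ⟨x, hx, rfl⟩⟩ h)
    refine Subtype.ext (Eq.symm ?_)
    refine (map_mul (Ideal.Quotient.mk (superfriezeIdeal K m)) _ x).trans ?_
    exact congrArg (· * Ideal.Quotient.mk (superfriezeIdeal K m) x)
      (map_mul (Ideal.Quotient.mk (superfriezeIdeal K m)) _ _)

theorem adjoin_even_quotient_eq_top (P : Ideal (superfriezeVariety K m).Even) [P.IsPrime] :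
    Algebra.adjoin K (Set.range fun i : ℤ => Ideal.Quotient.mk P
      ⟨superfriezeA K m i, (superfrieze_isSuperfrieze K m).even_mem i⟩) = ⊤ := by
  refine eq_top_iff.2 fun x _ => ?_
  obtain ⟨⟨_, ⟨x, hx, rfl⟩⟩, rfl⟩ := Ideal.Quotient.mk_surjective x
  exact even_mk_mem_adjoin K m P x hx

theorem finiteType_even_quotient (P : Ideal (superfriezeVariety K m).Even) [P.IsPrime] :
    Algebra.FiniteType K ((superfriezeVariety K m).Even ⧸ P) := by
  refine ⟨Subalgebra.fg_def.2 ⟨_, ?_, adjoin_even_quotient_eq_top K m P⟩⟩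
  have hV := superfrieze_isSuperfrieze K m
  refine (Set.finite_range fun k : Fin (m + 3) => Ideal.Quotient.mk P
    ⟨superfriezeA K m (k : ℕ), hV.even_mem (k : ℕ)⟩).subset ?_
  rintro _ ⟨i, rfl⟩
  have hpos : (0 : ℤ) < (m + 3 : ℕ) := by positivity
  have h1 := Int.emod_nonneg i hpos.ne'
  have h2 := Int.emod_lt_of_pos i hpos
  refine ⟨⟨(i % (m + 3 : ℕ)).toNat, by omega⟩, ?_⟩
  refine congrArg (Ideal.Quotient.mk P) (Subtype.ext ?_)
  change superfriezeA K m ((i % (m + 3 : ℕ)).toNat : ℕ) = superfriezeA K m i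
  conv_rhs => rw [← Int.emod_add_mul_ediv i (m + 3 : ℕ)]
  rw [Int.toNat_of_nonneg h1,
    periodic_zmul (a := superfriezeA K m) (by exact_mod_cast hV.periodic)]

theorem ringKrullDim_superfriezeVariety_even_le :
    ringKrullDim (superfriezeVariety K m).Even ≤ m := by
  refine ringKrullDim_le_of_forall_isPrime fun P hP => ?_
  have hV := superfrieze_isSuperfrieze K m
  let c : ℤ → (superfriezeVariety K m).Even ⧸ P := fun i =>
    Ideal.Quotient.mk P ⟨superfriezeA K m i, hV.even_mem i⟩
  let F : ℤ → ℕ → (superfriezeVariety K m).Even ⧸ P := fun j k =>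
    Ideal.Quotient.mk P ⟨_, (superfriezeVec_mem K m j k).2.1⟩
  have hF : ∀ j k (x : (superfriezeVariety K m).Even),
      friezeVec (superfriezeA K m) (superfriezeB K m) j k 1 = x → F j k = Ideal.Quotient.mk P x :=
    fun j k x h => congrArg _ (Subtype.ext h)
  have := finiteType_even_quotient K m P
  refine ringKrullDim_le_of_trdeg_le (K := K) (trdeg_le_of_frieze (c := c) (F := F)
    (fun i => congrArg (Ideal.Quotient.mk P) (Subtype.ext (hV.periodic i))) ?_ ?_ ?_ ?_ ?_
    (adjoin_even_quotient_eq_top K m P))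
  · intro j
    exact (hF j 0 0 (by simp [friezeVec])).trans (map_zero _)
  · intro j
    refine (hF j 1 1 ?_).trans (map_one _)
    simp [friezeVec, hillMatrix, Matrix.mulVec, dotProduct, Fin.sum_univ_three]
  · intro j k
    have h := (superfriezeVariety K m).odd_mul_odd_mem_of_isPrime P (hV.odd_mem (j + k))
      (superfriezeVec_mem K m j (k + 1)).2.2
    rw [hF j (k + 2) (⟨superfriezeA K m (j + k), hV.even_mem _⟩ *
      ⟨_, (superfriezeVec_mem K m j (k + 1)).2.1⟩ - ⟨_, (superfriezeVec_mem K m j k).2.1⟩ - ⟨_,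
        (superfriezeVariety K m).odd_mul_odd_mem (hV.odd_mem (j + k))
          (superfriezeVec_mem K m j (k + 1)).2.2⟩) (friezeVec_add_two _ _ j k),
      map_sub, Ideal.Quotient.eq_zero_iff_mem.2 h, sub_zero, map_sub, map_mul]
  · intro j
    refine (hF j (m + 2) 1 ?_).trans (map_one _)
    rw [← friezeEven_eq_friezeVec]
    exact hV.row_one j
  · intro j
    refine (hF j (m + 3) 0 ?_).trans (map_zero _)
    rw [← friezeEven_eq_friezeVec_succ]
    exact hV.row_zero_even j

/-- The last step of the odd recurrence reads `0 = β_{j+m+1} · 1 + φ_{j,j+m}`, where `φ_{j,j+m}`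
only involves `β_j, …, β_{j+m}`. Two such steps fill a period, and antiperiodicity does the rest. -/
theorem superfriezeB_mem_span (i : ℤ) : superfriezeB K m i ∈
    Submodule.span (superfriezeVariety K m).Even
      (Set.range fun k : Fin (m + 1) => superfriezeB K m (k : ℕ)) := by
  set W := Submodule.span (superfriezeVariety K m).Even
      (Set.range fun k : Fin (m + 1) => superfriezeB K m (k : ℕ))
  have hV := superfrieze_isSuperfrieze K m
  have hmul : ∀ i j k, superfriezeB K m i ∈ W →
      superfriezeB K m i * friezeVec (superfriezeA K m) (superfriezeB K m) j k 1 ∈ W := by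
    intro i j k h
    rw [← IsSupercommutative.even_comm (𝒜 := (superfriezeVariety K m).grading) _
      (superfriezeVec_mem K m j k).2.1]
    exact W.smul_mem (⟨_, (superfriezeVec_mem K m j k).2.1⟩ : (superfriezeVariety K m).Even) h
  have hvec : ∀ (j : ℤ) (k : ℕ), (∀ l : ℕ, l < k → superfriezeB K m (j + l) ∈ W) →
      friezeVec (superfriezeA K m) (superfriezeB K m) j (k + 1) 2 ∈ W := by
    intro j k
    induction k with
    | zero =>
      intro _
      -- The first odd entry is `β_{j-1} f_{j,j-2} = 0`, so `β_{j-1}` does not enter the diagonal.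
      simp [friezeVec, hillMatrix, Matrix.mulVec, dotProduct, Fin.sum_univ_three]
    | succ k ih =>
      intro h
      rw [friezeVec_odd_succ]
      refine add_mem (hmul _ _ _ ?_) (ih fun l hl => h l (by omega))
      convert h k (by omega) using 2
      push_cast; ring
  have hnext : ∀ j : ℤ, (∀ l : ℕ, l < m + 1 → superfriezeB K m (j + l) ∈ W) →
      superfriezeB K m (j + (m + 1 : ℕ)) ∈ W := by
    intro j h
    have h1 := hvec j (m + 1) h
    have h2 : friezeVec (superfriezeA K m) (superfriezeB K m) j (m + 3) 2 = 0 := by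
      rw [← friezeOdd_eq_friezeVec_succ]
      exact hV.row_zero_odd j
    have h3 : friezeVec (superfriezeA K m) (superfriezeB K m) j (m + 2) 1 = 1 := by
      rw [← friezeEven_eq_friezeVec]
      exact hV.row_one j
    rw [friezeVec_odd_succ, h3, mul_one, add_eq_zero_iff_eq_neg] at h2
    convert neg_mem h1 using 1
    rw [← h2]
    congr 1; push_cast; ring
  have hlow : ∀ l : ℕ, l < m + 1 → superfriezeB K m l ∈ W := fun l hl =>
    Submodule.subset_span ⟨⟨l, hl⟩, rfl⟩
  have h1 : superfriezeB K m (m + 1 : ℕ) ∈ W := by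
    simpa using hnext 0 fun l hl => by simpa using hlow l hl
  have h2 : superfriezeB K m (m + 2 : ℕ) ∈ W := by
    convert hnext 1 fun l hl => ?_ using 2
    · push_cast; ring
    · rcases Nat.lt_succ_iff_lt_or_eq.1 hl with h | rfl
      · convert hlow (l + 1) (by omega) using 2; push_cast; ring
      · convert h1 using 2; push_cast; ring
  have hall : ∀ l : ℕ, l < m + 3 → superfriezeB K m l ∈ W := fun l hl => by
    rcases (by omega : l < m + 1 ∨ l = m + 1 ∨ l = m + 2) with h | rfl | rfl
    exacts [hlow l h, h1, h2]
  have hpos : (0 : ℤ) < (m + 3 : ℕ) := by positivity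
  have h1 := Int.emod_nonneg i hpos.ne'
  have h2 := Int.emod_lt_of_pos i hpos
  have h3 := hall (i % (m + 3 : ℕ)).toNat (by omega)
  rw [Int.toNat_of_nonneg h1] at h3
  rw [← Int.emod_add_mul_ediv i (m + 3 : ℕ),
    antiperiodic_zmul (b := superfriezeB K m) (by exact_mod_cast hV.antiperiodic)]
  rcases Int.units_eq_one_or (i / ((m + 3 : ℕ) : ℤ)).negOnePow with e | e <;> rw [e]
  · rwa [one_smul]
  · rw [Units.neg_smul, one_smul]
    exact neg_mem h3

theorem odd_mem_span_superfriezeB (y : (superfriezeVariety K m).coord)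
    (hy : y ∈ (superfriezeVariety K m).grading 1) :
    y ∈ Submodule.span (superfriezeVariety K m).Even
      (Set.range fun k : Fin (m + 1) => superfriezeB K m (k : ℕ)) := by
  set W := Submodule.span (superfriezeVariety K m).Even
      (Set.range fun k : Fin (m + 1) => superfriezeB K m (k : ℕ))
  obtain ⟨x, hx, rfl⟩ := hy
  change Ideal.Quotient.mk (superfriezeIdeal K m) x ∈ W
  change x ∈ CliffordAlgebra.evenOdd _ 1 at hx
  have hmul : ∀ z ∈ CliffordAlgebra.evenOdd (0 : QuadraticForm (MvPolynomial (ZMod (m + 3)) K)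
      (ZMod (m + 3) → MvPolynomial (ZMod (m + 3)) K)) 0, ∀ x,
      Ideal.Quotient.mk (superfriezeIdeal K m) x ∈ W →
      Ideal.Quotient.mk (superfriezeIdeal K m) (z * x) ∈ W := fun z hz x hx => by
    rw [map_mul]
    exact W.smul_mem (⟨_, ⟨z, hz, rfl⟩⟩ : (superfriezeVariety K m).Even) hx
  induction x, hx using CliffordAlgebra.odd_induction with
  | ι v =>
    have hv : v = ∑ k, v k • (Pi.single k 1 :
        ZMod (m + 3) → MvPolynomial (ZMod (m + 3)) K) := by
      ext l
      simp [Finset.sum_apply, Pi.single_apply]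
    rw [hv, map_sum, map_sum]
    refine sum_mem fun k _ => ?_
    rw [map_smul, Algebra.smul_def]
    refine hmul _ (SetLike.algebraMap_mem_graded (CliffordAlgebra.evenOdd _) _) _ ?_
    obtain ⟨i, rfl⟩ := ZMod.intCast_surjective k
    have h := superfriezeB_mem_span K m i
    rw [superfriezeB, polyB] at h
    rcases Int.units_eq_one_or ((i - 1) / ((m + 3 : ℕ) : ℤ)).negOnePow with e | e <;> rw [e] at h
    · rwa [one_smul] at h
    · rw [Units.neg_smul, one_smul, map_neg] at h
      exact neg_mem_iff.1 h
  | add x y _ _ hx hy => rw [map_add]; exact add_mem hx hy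
  | ι_mul_ι_mul v w x _ hx =>
    exact hmul _ (CliffordAlgebra.ι_mul_ι_mem_evenOdd_zero _ v w) _ hx

theorem superfriezeVariety_prod_odd_eq_zero {s : ℕ} (hs : m + 1 < s)
    {y : Fin s → (superfriezeVariety K m).coord}
    (hy : ∀ k, y k ∈ (superfriezeVariety K m).grading 1) : (List.ofFn y).prod = 0 :=
  (superfriezeVariety K m).prod_odd_eq_zero hs
    (fun _ => (superfrieze_isSuperfrieze K m).odd_mem _) (odd_mem_span_superfriezeB K m) hy

end

/-! ### Hill matrices in `OSp(1|2)` and superfriezes with prescribed parameters. -/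

section Orthosymplectic

open Matrix

variable {R : Type*} [Ring R]

/-- The inverse of an element of the orthosymplectic group `OSp(1|2)`. -/
def ospAdjoint (M : Matrix (Fin 3) (Fin 3) R) : Matrix (Fin 3) (Fin 3) R :=
  !![M 1 1, -M 0 1, -M 2 1;
     -M 1 0, M 0 0, M 2 0;
     M 1 2, -M 0 2, M 2 2]

/-- The inverse of `hillMatrix`. -/
def hillInverse (a b : ℤ → R) (i : ℤ) : Matrix (Fin 3) (Fin 3) R :=
  !![a i, -1, -b i;
     1, 0, 0;
     -b i, 0, 1]

/-- The product of the `k` matrices `A_{i+k-1} ⋯ A_i`. -/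
def hillProd (a b : ℤ → R) (i : ℤ) : ℕ → Matrix (Fin 3) (Fin 3) R
  | 0 => 1
  | k + 1 => hillMatrix a b (i + k) * hillProd a b i k

theorem hillProd_succ_right (a b : ℤ → R) (i : ℤ) (k : ℕ) :
    hillProd a b i (k + 1) = hillProd a b (i + 1) k * hillMatrix a b i := by
  induction k with
  | zero => simp [hillProd]
  | succ k ih =>
    rw [hillProd, ih, hillProd, Matrix.mul_assoc]
    congr 2
    push_cast; ring

theorem friezeVec_eq_hillProd (a b : ℤ → R) (j : ℤ) (k : ℕ) :
    friezeVec a b j k = hillProd a b (j - 1) k *ᵥ ![-1, 0, 0] := by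
  induction k with
  | zero => simp [hillProd, friezeVec]
  | succ k ih => rw [friezeVec, ih, hillProd, Matrix.mulVec_mulVec]

theorem hillProd_map {S : Type*} [Ring S] (φ : R →+* S) (a b : ℤ → R) (i : ℤ) (k : ℕ) :
    (hillProd a b i k).map φ = hillProd (fun i => φ (a i)) (fun i => φ (b i)) i k := by
  induction k with
  | zero => simp [hillProd]
  | succ k ih =>
    rw [hillProd, hillProd, Matrix.map_mul, ih]
    congr 1
    ext i j
    fin_cases i <;> fin_cases j <;> simp [hillMatrix]

theorem hillProd_congr {a b a' b' : ℤ → R} {k : ℕ} (ha : ∀ l : ℕ, l < k → a l = a' l)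
    (hb : ∀ l : ℕ, l < k → b l = b' l) : hillProd a b 0 k = hillProd a' b' 0 k := by
  induction k with
  | zero => rfl
  | succ k ih =>
    rw [hillProd, hillProd, ih (fun l hl => ha l (by omega)) (fun l hl => hb l (by omega)),
      hillMatrix, hillMatrix, zero_add, ha k (by omega), hb k (by omega)]

/-- The parity automorphism matrix `diag(1, 1, -1)`. -/
def parityMatrix : Matrix (Fin 3) (Fin 3) R := !![1, 0, 0; 0, 1, 0; 0, 0, -1]

theorem parityMatrix_mul_self : (parityMatrix : Matrix (Fin 3) (Fin 3) R) * parityMatrix = 1 := by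
  ext i j
  fin_cases i <;> fin_cases j <;> simp [parityMatrix, Matrix.mul_apply, Fin.sum_univ_three]

theorem hillMatrix_add_period {a b : ℤ → R} {n : ℤ} (ha : ∀ i, a (i + n) = a i)
    (hb : ∀ i, b (i + n) = -b i) (i : ℤ) :
    hillMatrix a b (i + n) = parityMatrix * hillMatrix a b i * parityMatrix := by
  rw [hillMatrix, hillMatrix, ha, hb]
  ext i j
  fin_cases i <;> fin_cases j <;> simp [parityMatrix, Matrix.mul_apply, Fin.sum_univ_three]

section Super

variable {K : Type*} [CommRing K] [Algebra K R] (𝒜 : ZMod 2 → Submodule K R)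

/-- The matrices in `OSp(1|2)` of Berezinian one. -/
structure IsSOSp (M : Matrix (Fin 3) (Fin 3) R) : Prop where
  even00 : M 0 0 ∈ 𝒜 0
  even01 : M 0 1 ∈ 𝒜 0
  even10 : M 1 0 ∈ 𝒜 0
  even11 : M 1 1 ∈ 𝒜 0
  even22 : M 2 2 ∈ 𝒜 0
  odd02 : M 0 2 ∈ 𝒜 1
  odd12 : M 1 2 ∈ 𝒜 1
  odd20 : M 2 0 ∈ 𝒜 1
  odd21 : M 2 1 ∈ 𝒜 1
  mul_adjoint : M * ospAdjoint M = 1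
  adjoint_mul : ospAdjoint M * M = 1
  berezinian : M 2 2 = 1 + M 0 2 * M 1 2

variable {𝒜} {a b : ℤ → R}

theorem IsSOSp.one [GradedAlgebra 𝒜] : IsSOSp 𝒜 (1 : Matrix (Fin 3) (Fin 3) R) := by
  have h1 : (1 : R) ∈ 𝒜 0 := SetLike.GradedOne.one_mem
  have hadj : ospAdjoint (1 : Matrix (Fin 3) (Fin 3) R) = 1 := by
    ext i j
    fin_cases i <;> fin_cases j <;> simp [ospAdjoint]
  constructor <;> simp [h1, hadj]

/-- A matrix with `1` in the middle is completed by one Hill matrix to a matrix with middle row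
`(-1, 0, 0)`. -/
theorem IsSOSp.hillMatrix_mul_row_one {T : Matrix (Fin 3) (Fin 3) R} (hT : IsSOSp 𝒜 T)
    (h : T 1 1 = 1) {i : ℤ} (ha : a i = T 0 1) (hb : b i = -T 2 1) :
    (hillMatrix a b i * T) 1 0 = -1 ∧ (hillMatrix a b i * T) 1 1 = 0 ∧
      (hillMatrix a b i * T) 1 2 = 0 := by
  -- With these values of `a i` and `b i`, the middle row of the Hill matrix is minus the first row
  -- of `ospAdjoint T`.
  have e : ∀ j, (hillMatrix a b i * T) 1 j = -(ospAdjoint T * T) 0 j := fun j => by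
    simp [hillMatrix, ospAdjoint, Matrix.mul_apply, Fin.sum_univ_three, ha, hb, h]
    abel
  rw [e, e, e, hT.adjoint_mul]
  simp

variable [IsSupercommutative 𝒜]

variable (𝒜) in

theorem hillMatrix_mul_hillInverse {i : ℤ} (hb : b i ∈ 𝒜 1) :
    hillMatrix a b i * hillInverse a b i = 1 := by
  have h := IsSupercommutative.odd_sq (𝒜 := 𝒜) _ hb
  ext k l
  fin_cases k <;> fin_cases l <;>
    simp [hillMatrix, hillInverse, Matrix.mul_apply, Fin.sum_univ_three, h]

variable (𝒜) in
theorem hillInverse_mul_hillMatrix {i : ℤ} (hb : b i ∈ 𝒜 1) :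
    hillInverse a b i * hillMatrix a b i = 1 := by
  have h := IsSupercommutative.odd_sq (𝒜 := 𝒜) _ hb
  ext k l
  fin_cases k <;> fin_cases l <;>
    simp [hillMatrix, hillInverse, Matrix.mul_apply, Fin.sum_univ_three, h]

/-- `hillInverse` is the adjoint of `hillMatrix`, and adjoints reverse products: moving odd entries
past each other produces exactly the signs in `ospAdjoint`. -/
theorem ospAdjoint_hillMatrix_mul {i : ℤ} (ha : a i ∈ 𝒜 0) (hb : b i ∈ 𝒜 1)
    {M : Matrix (Fin 3) (Fin 3) R} (hM : IsSOSp 𝒜 M) :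
    ospAdjoint (hillMatrix a b i * M) = ospAdjoint M * hillInverse a b i := by
  have ca := IsSupercommutative.even_comm (𝒜 := 𝒜) _ ha
  have ce : ∀ x ∈ 𝒜 0, b i * x = x * b i := fun x hx =>
    (IsSupercommutative.even_comm (𝒜 := 𝒜) x hx (b i)).symm
  have co := IsSupercommutative.odd_anticomm (𝒜 := 𝒜) _ hb
  ext k l
  fin_cases k <;> fin_cases l <;>
    simp [hillMatrix, hillInverse, ospAdjoint, Matrix.mul_apply, Fin.sum_univ_three, ca,
      ce _ hM.even10, ce _ hM.even11, ce _ hM.even22,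
      co _ hM.odd12, co _ hM.odd20, co _ hM.odd21] <;> abel

/-- The orthosymplectic relations leave only `H 0 0` and `H 0 2` free once the middle row is `(-1,
0, 0)`; such an `H` is a `hillInverse` times `-parityMatrix`. -/
theorem IsSOSp.hillMatrix_mul_eq {H : Matrix (Fin 3) (Fin 3) R} (hH : IsSOSp 𝒜 H)
    (h0 : H 1 0 = -1) (h1 : H 1 1 = 0) (h2 : H 1 2 = 0) {i : ℤ} (ha : a i = -H 0 0)
    (hb : b i = -H 0 2) : hillMatrix a b i * H = -parityMatrix := by
  -- The adjoint relations alone only control the square of `H 2 2`; the Berezinian condition fixes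
  -- its value, in every characteristic.
  have e22 : H 2 2 = 1 := by rw [hH.berezinian, h2, mul_zero, add_zero]
  have e01 : H 0 1 = 1 := by
    have := congrFun₂ hH.mul_adjoint 0 0
    simpa [ospAdjoint, Matrix.mul_apply, Fin.sum_univ_three, h0, h1, h2] using this
  have e21 : H 2 1 = 0 := by
    have := congrFun₂ hH.mul_adjoint 2 0
    simpa [ospAdjoint, Matrix.mul_apply, Fin.sum_univ_three, h0, h1, h2] using this
  have e20 : H 2 0 = -H 0 2 := by
    have := congrFun₂ hH.mul_adjoint 2 1
    simp [ospAdjoint, Matrix.mul_apply, Fin.sum_univ_three, e22, e01, e21] at this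
    exact neg_injective (add_eq_zero_iff_eq_neg.1 this)
  have hsq := IsSupercommutative.odd_sq (𝒜 := 𝒜) _ hH.odd02
  ext k l
  fin_cases k <;> fin_cases l <;>
    simp [hillMatrix, parityMatrix, Matrix.mul_apply, Fin.sum_univ_three, h0, h1, h2, e22, e01, e21,
      e20, ha, hb, hsq]

/-- (Anti)periodic solutions with monodromy `diag(-1, -1, 1)` are superfriezes. -/
theorem isSuperfrieze_of_hillProd {m : ℕ} (ha : ∀ i, a i ∈ 𝒜 0) (hb : ∀ i, b i ∈ 𝒜 1)
    (hper : ∀ i, a (i + (m + 3)) = a i) (hanti : ∀ i, b (i + (m + 3)) = -b i)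
    (h : hillProd a b 0 (m + 3) = -parityMatrix) : IsSuperfrieze 𝒜 m a b := by
  -- Shifting the window by one conjugates the monodromy by a Hill matrix, up to the parity twist of
  -- `A_{i+n}`. The value `-parityMatrix` is stable under this, so it passes from index `0` to all
  -- indices.
  have hcomm : ∀ i, parityMatrix * (hillMatrix a b i * (parityMatrix * hillProd a b i (m + 3))) =
      hillProd a b (i + 1) (m + 3) * hillMatrix a b i := fun i => by
    rw [← hillProd_succ_right, hillProd, ← Matrix.mul_assoc, ← Matrix.mul_assoc,
      ← hillMatrix_add_period hper hanti]
    push_cast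
    rfl
  have hall : ∀ i, hillProd a b i (m + 3) = -parityMatrix := by
    intro i
    induction i using Int.induction_on with
    | zero => exact h
    | succ i ih =>
      have := congrArg (· * hillInverse a b i) (hcomm i)
      simp only [ih, Matrix.mul_neg, parityMatrix_mul_self, Matrix.mul_one, Matrix.mul_assoc,
        Matrix.neg_mul, hillMatrix_mul_hillInverse 𝒜 (hb i)] at this
      exact this.symm
    | pred i ih =>
      have h1 := hcomm (-(i : ℤ) - 1)
      rw [sub_add_cancel, ih, Matrix.neg_mul, ← Matrix.mul_neg] at h1
      have h2 := congrArg (parityMatrix * ·) h1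
      simp only [← Matrix.mul_assoc, parityMatrix_mul_self, Matrix.one_mul] at h2
      have h3 := congrArg (hillInverse a b (-(i : ℤ) - 1) * ·) h2
      simp only [← Matrix.mul_assoc, Matrix.mul_neg, hillInverse_mul_hillMatrix 𝒜 (hb _), Matrix.one_mul] at h3
      have h4 := congrArg (parityMatrix * ·) h3
      simpa only [← Matrix.mul_assoc, parityMatrix_mul_self, Matrix.one_mul, Matrix.mul_neg,
        Matrix.mul_one] using h4
  have hvec : ∀ j, friezeVec a b j (m + 3) = ![1, 0, 0] := fun j => by
    rw [friezeVec_eq_hillProd, hall]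
    ext i
    fin_cases i <;> simp [parityMatrix, Matrix.mulVec, dotProduct, Fin.sum_univ_three]
  refine ⟨ha, hb, hper, hanti, fun j => ?_, fun j => ?_, fun j => ?_⟩
  · rw [friezeEven_eq_friezeVec]
    have := congrFun (hvec j) 0
    rw [friezeVec] at this
    simpa [hillMatrix, Matrix.mulVec, dotProduct, Fin.sum_univ_three] using this
  · rw [friezeOdd_eq_friezeVec_succ, hvec]
    rfl
  · rw [friezeEven_eq_friezeVec_succ, hvec]
    rfl

variable [GradedAlgebra 𝒜]

theorem IsSOSp.hillMatrix_mul {i : ℤ} (ha : a i ∈ 𝒜 0) (hb : b i ∈ 𝒜 1)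
    {M : Matrix (Fin 3) (Fin 3) R} (hM : IsSOSp 𝒜 M) : IsSOSp 𝒜 (hillMatrix a b i * M) := by
  have m00 : ∀ {x y : R}, x ∈ 𝒜 0 → y ∈ 𝒜 0 → x * y ∈ 𝒜 0 := fun hx hy =>
    SetLike.mul_mem_graded (A := 𝒜) hx hy
  have m01 : ∀ {x y : R}, x ∈ 𝒜 0 → y ∈ 𝒜 1 → x * y ∈ 𝒜 1 := fun hx hy =>
    SetLike.mul_mem_graded (A := 𝒜) hx hy
  have m10 : ∀ {x y : R}, x ∈ 𝒜 1 → y ∈ 𝒜 0 → x * y ∈ 𝒜 1 := fun hx hy =>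
    SetLike.mul_mem_graded (A := 𝒜) hx hy
  have m11 : ∀ {x y : R}, x ∈ 𝒜 1 → y ∈ 𝒜 1 → x * y ∈ 𝒜 0 := fun hx hy =>
    SetLike.mul_mem_graded (A := 𝒜) hx hy
  have e0 : ∀ j, (hillMatrix a b i * M) 0 j = M 1 j := fun j => by
    simp [hillMatrix, Matrix.mul_apply, Fin.sum_univ_three]
  have e1 : ∀ j, (hillMatrix a b i * M) 1 j = -M 0 j + a i * M 1 j + -(b i * M 2 j) := fun j => by
    simp [hillMatrix, Matrix.mul_apply, Fin.sum_univ_three]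
  have e2 : ∀ j, (hillMatrix a b i * M) 2 j = b i * M 1 j + M 2 j := fun j => by
    simp [hillMatrix, Matrix.mul_apply, Fin.sum_univ_three]
  refine ⟨?_, ?_, ?_, ?_, ?_, ?_, ?_, ?_, ?_, ?_, ?_, ?_⟩
  · rw [e0]; exact hM.even10
  · rw [e0]; exact hM.even11
  · rw [e1]; exact add_mem (add_mem (neg_mem hM.even00) (m00 ha hM.even10)) (neg_mem (m11 hb hM.odd20))
  · rw [e1]; exact add_mem (add_mem (neg_mem hM.even01) (m00 ha hM.even11)) (neg_mem (m11 hb hM.odd21))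
  · rw [e2]; exact add_mem (m11 hb hM.odd12) hM.even22
  · rw [e0]; exact hM.odd12
  · rw [e1]; exact add_mem (add_mem (neg_mem hM.odd02) (m01 ha hM.odd12)) (neg_mem (m10 hb hM.even22))
  · rw [e2]; exact add_mem (m10 hb hM.even10) hM.odd20
  · rw [e2]; exact add_mem (m10 hb hM.even11) hM.odd21
  · rw [ospAdjoint_hillMatrix_mul ha hb hM, Matrix.mul_assoc, ← Matrix.mul_assoc M,
      hM.mul_adjoint, Matrix.one_mul, hillMatrix_mul_hillInverse 𝒜 hb]
  · rw [ospAdjoint_hillMatrix_mul ha hb hM, Matrix.mul_assoc, ← Matrix.mul_assoc _ _ M,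
      hillInverse_mul_hillMatrix 𝒜 hb, Matrix.one_mul, hM.adjoint_mul]
  · rw [e0, e1, e2, hM.berezinian]
    have h1 := IsSupercommutative.odd_anticomm (𝒜 := 𝒜) _ hM.odd12 _ hM.odd02
    have h2 := IsSupercommutative.odd_anticomm (𝒜 := 𝒜) _ hM.odd12 _ hb
    have h3 := IsSupercommutative.odd_sq (𝒜 := 𝒜) _ hM.odd12
    have h4 := (IsSupercommutative.even_comm (𝒜 := 𝒜) _ ha (M 1 2)).symm
    have h5 : M 1 2 * (a i * M 1 2) = 0 := by rw [← mul_assoc, h4, mul_assoc, h3, mul_zero]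
    have h6 : M 1 2 * (b i * (M 0 2 * M 1 2)) = 0 := by
      rw [← mul_assoc, h2, neg_mul, mul_assoc, ← mul_assoc (M 1 2), h1, neg_mul, mul_assoc, h3]
      simp
    simp only [mul_add, mul_neg, mul_one, h1, h2, h5, h6]
    abel

theorem isSOSp_hillProd (ha : ∀ i, a i ∈ 𝒜 0) (hb : ∀ i, b i ∈ 𝒜 1) (i : ℤ) (k : ℕ) :
    IsSOSp 𝒜 (hillProd a b i k) := by
  induction k with
  | zero => exact IsSOSp.one
  | succ k ih => exact ih.hillMatrix_mul (ha _) (hb _)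

/-- The first `m` Hill matrices and one more odd entry determine `m + 3` matrices with monodromy
`diag(-1, -1, 1)`, if the middle entry of their product is invertible. -/
theorem exists_hillProd_eq_neg_parityMatrix {m : ℕ} {x θ : ℤ → R} (hx : ∀ i, x i ∈ 𝒜 0)
    (hθ : ∀ i, θ i ∈ 𝒜 1) {w : R} (hw : w ∈ 𝒜 0) (hw1 : w * hillProd x θ 0 m 1 1 = 1) :
    ∃ a b : ℤ → R, (∀ i, a i ∈ 𝒜 0) ∧ (∀ i, b i ∈ 𝒜 1) ∧ (∀ k : ℕ, k < m → a k = x k) ∧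
      (∀ k : ℕ, k < m + 1 → b k = θ k) ∧ hillProd a b 0 (m + 3) = -parityMatrix := by
  have hG := isSOSp_hillProd hx hθ 0 m
  set G := hillProd x θ 0 m
  have m00 : ∀ {x y : R}, x ∈ 𝒜 0 → y ∈ 𝒜 0 → x * y ∈ 𝒜 0 := fun hx hy =>
    SetLike.mul_mem_graded (A := 𝒜) hx hy
  have m11 : ∀ {x y : R}, x ∈ 𝒜 1 → y ∈ 𝒜 1 → x * y ∈ 𝒜 0 := fun hx hy =>
    SetLike.mul_mem_graded (A := 𝒜) hx hy
  have h1 : (1 : R) ∈ 𝒜 0 := SetLike.GradedOne.one_mem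
  -- This is the solution `a_m` of `-G 0 1 + a_m * G 1 1 - θ_m * G 2 1 = 1`, which makes the middle
  -- entry of the next product `1`.
  let a₁ : ℤ → R := Function.update x m ((1 + G 0 1 + θ m * G 2 1) * w)
  have ha₁ : ∀ i, a₁ i ∈ 𝒜 0 := fun i => by
    by_cases h : i = m
    · subst h
      simp only [a₁, Function.update_self]
      exact m00 (add_mem (add_mem h1 hG.even01) (m11 (hθ _) hG.odd21)) hw
    · simpa [a₁, h] using hx i
  have hT := isSOSp_hillProd ha₁ hθ 0 (m + 1)
  have hT11 : hillProd a₁ θ 0 (m + 1) 1 1 = 1 := by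
    have : hillProd a₁ θ 0 m = G := hillProd_congr
      (fun l hl => by simp [a₁, hl.ne]) fun _ _ => rfl
    rw [hillProd, this]
    simp [hillMatrix, Matrix.mul_apply, Fin.sum_univ_three, a₁, mul_assoc, hw1]
    abel
  set T := hillProd a₁ θ 0 (m + 1) with hTdef
  let a₂ : ℤ → R := Function.update a₁ (m + 1 : ℕ) (T 0 1)
  let b₂ : ℤ → R := Function.update θ (m + 1 : ℕ) (-T 2 1)
  have ha₂ : ∀ i, a₂ i ∈ 𝒜 0 := fun i => by
    by_cases h : i = (m + 1 : ℕ)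
    · subst h
      simpa only [a₂, Function.update_self] using hT.even01
    · simpa only [a₂, Function.update_of_ne h] using ha₁ i
  have hb₂ : ∀ i, b₂ i ∈ 𝒜 1 := fun i => by
    by_cases h : i = (m + 1 : ℕ)
    · subst h
      simpa only [b₂, Function.update_self] using neg_mem hT.odd21
    · simpa only [b₂, Function.update_of_ne h] using hθ i
  have hne : ∀ {k l : ℕ}, l < k → (l : ℤ) ≠ (k : ℕ) := fun h => by omega
  have hH := isSOSp_hillProd ha₂ hb₂ 0 (m + 2)
  have hHT : hillProd a₂ b₂ 0 (m + 2) = hillMatrix a₂ b₂ (0 + (m + 1 : ℕ)) * T := by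
    rw [hillProd, hTdef, hillProd_congr (a' := a₁) (b' := θ)]
    · exact fun l hl => Function.update_of_ne (hne hl) _ _
    · exact fun l hl => Function.update_of_ne (hne hl) _ _
  obtain ⟨r0, r1, r2⟩ := hT.hillMatrix_mul_row_one (a := a₂) (b := b₂) hT11
    (i := 0 + (m + 1 : ℕ)) (by rw [zero_add]; exact Function.update_self _ _ _)
    (by rw [zero_add]; exact Function.update_self _ _ _)
  rw [← hHT] at r0 r1 r2
  set H := hillProd a₂ b₂ 0 (m + 2) with hHdef
  -- The last pair is forced by comparing `H` with the inverse Hill matrix times the required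
  -- monodromy.
  let a₃ : ℤ → R := Function.update a₂ (m + 2 : ℕ) (-H 0 0)
  let b₃ : ℤ → R := Function.update b₂ (m + 2 : ℕ) (-H 0 2)
  refine ⟨a₃, b₃, fun i => ?_, fun i => ?_, fun k hk => ?_, fun k hk => ?_, ?_⟩
  · by_cases h : i = (m + 2 : ℕ)
    · subst h
      simpa only [a₃, Function.update_self] using neg_mem hH.even00
    · simpa only [a₃, Function.update_of_ne h] using ha₂ i
  · by_cases h : i = (m + 2 : ℕ)
    · subst h
      simpa only [b₃, Function.update_self] using neg_mem hH.odd02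
    · simpa only [b₃, Function.update_of_ne h] using hb₂ i
  · simp only [a₃, a₂, a₁]
    rw [Function.update_of_ne (hne (by omega)), Function.update_of_ne (hne (by omega)),
      Function.update_of_ne (hne hk)]
  · simp only [b₃, b₂]
    rw [Function.update_of_ne (hne (by omega)), Function.update_of_ne (hne (by omega))]
  · rw [hillProd, hillProd_congr (a' := a₂) (b' := b₂) (k := m + 2)]
    · exact hH.hillMatrix_mul_eq r0 r1 r2 (by rw [zero_add]; exact Function.update_self _ _ _)
        (by rw [zero_add]; exact Function.update_self _ _ _)
    · exact fun l hl => Function.update_of_ne (hne hl) _ _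
    · exact fun l hl => Function.update_of_ne (hne hl) _ _

theorem exists_isSuperfrieze {m : ℕ} {x θ : ℤ → R} (hx : ∀ i, x i ∈ 𝒜 0)
    (hθ : ∀ i, θ i ∈ 𝒜 1) {w : R} (hw : w ∈ 𝒜 0) (hw1 : w * hillProd x θ 0 m 1 1 = 1) :
    ∃ a b : ℤ → R, IsSuperfrieze 𝒜 m a b ∧ (∀ k : ℕ, k < m → a k = x k) ∧
      ∀ k : ℕ, k < m + 1 → b k = θ k := by
  obtain ⟨a, b, ha, hb, hax, hbθ, h⟩ := exists_hillProd_eq_neg_parityMatrix hx hθ hw hw1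
  have hpos : (0 : ℤ) < (m + 3 : ℕ) := by positivity
  have hmod : ∀ k : ℕ, k < m + 3 → (k : ℤ) % (m + 3 : ℕ) = k := fun k hk =>
    Int.emod_eq_of_lt (by omega) (by omega)
  have hdiv : ∀ k : ℕ, k < m + 3 → (k : ℤ) / (m + 3 : ℕ) = 0 := fun k hk =>
    Int.ediv_eq_zero_of_lt (by omega) (by omega)
  let a' : ℤ → R := fun i => a (i % (m + 3 : ℕ))
  let b' : ℤ → R := fun i => (i / (m + 3 : ℕ)).negOnePow • b (i % (m + 3 : ℕ))
  have ha' : ∀ k : ℕ, k < m + 3 → a' k = a k := fun k hk => by simp only [a', hmod k hk]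
  have hb' : ∀ k : ℕ, k < m + 3 → b' k = b k := fun k hk => by
    simp only [b', hmod k hk, hdiv k hk, Int.negOnePow_zero, one_smul]
  refine ⟨a', b', isSuperfrieze_of_hillProd (fun i => ha _) (fun i => ?_) (fun i => ?_)
    (fun i => ?_) ?_, fun k hk => ?_, fun k hk => ?_⟩
  · rcases Int.units_eq_one_or (i / ((m + 3 : ℕ) : ℤ)).negOnePow with e | e <;>
      simp only [b', e, Units.neg_smul, one_smul]
    exacts [hb _, neg_mem (hb _)]
  · have : ((m : ℤ) + 3) = (m + 3 : ℕ) := by push_cast; ring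
    simp only [a', this, Int.add_emod_right]
  · have : ((m : ℤ) + 3) = (m + 3 : ℕ) := by push_cast; ring
    simp only [b', this, Int.add_emod_right]
    rw [Int.add_ediv_of_dvd_right dvd_rfl, Int.ediv_self hpos.ne', Int.negOnePow_succ,
      Units.neg_smul]
  · rw [hillProd_congr ha' hb', h]
  · rw [ha' k (by omega), hax k hk]
  · rw [hb' k (by omega), hbθ k hk]

end Super

end Orthosymplectic

/-! ### Body and top form of an exterior algebra. -/

section Exterior

open CliffordAlgebra

variable (K : Type*) [CommRing K] (L : Type*) [CommRing L] [Algebra K L] (M : Type*)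
  [AddCommGroup M] [Module L M] [Module K M] [IsScalarTower K L M]

/-- The `ℤ/2`-grading of an exterior algebra, as an algebra over a smaller base ring. -/
noncomputable def exteriorGrading (i : ZMod 2) : Submodule K (ExteriorAlgebra L M) :=
  (evenOdd (0 : QuadraticForm L M) i).restrictScalars K

instance exteriorGrading.gradedMonoid : SetLike.GradedMonoid (exteriorGrading K L M) where
  one_mem := SetLike.GradedOne.one_mem (A := evenOdd (0 : QuadraticForm L M))
  mul_mem _ _ _ _ hx hy := SetLike.GradedMul.mul_mem (A := evenOdd (0 : QuadraticForm L M)) hx hy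

noncomputable instance exteriorGrading.gradedAlgebra : GradedAlgebra (exteriorGrading K L M) :=
  gradedOfIsCompl _ (by
    have h := evenOdd_isCompl (0 : QuadraticForm L M)
    constructor
    · rw [Submodule.disjoint_def]
      intro x hx hy
      exact Submodule.disjoint_def.1 h.1 x hx hy
    · rw [codisjoint_iff, Submodule.eq_top_iff']
      intro x
      obtain ⟨y, hy, z, hz, rfl⟩ := Submodule.mem_sup.1
        ((codisjoint_iff.1 h.2 ▸ Submodule.mem_top : x ∈ evenOdd _ 0 ⊔ evenOdd _ 1))
      exact Submodule.add_mem_sup hy hz)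

instance exteriorGrading.supercommutative : IsSupercommutative (exteriorGrading K L M) where
  even_comm x hx y := exterior_even_comm x hx y
  odd_anticomm x hx y hy := exterior_odd_anticomm x hx y hy
  odd_sq x hx := exterior_odd_sq x hx

variable {L M}

/-- A product beginning with `ι v * ι w` squares to zero, and sums of commuting nilpotents are
nilpotent. Hence an even element with invertible body is invertible. -/
theorem exterior_isNilpotent_sub_algebraMap (x : ExteriorAlgebra L M)
    (hx : x ∈ evenOdd (0 : QuadraticForm L M) 0) :
    IsNilpotent (x - algebraMap L _ (ExteriorAlgebra.algebraMapInv x)) := by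
  have hmem : ∀ x ∈ evenOdd (0 : QuadraticForm L M) 0,
      x - algebraMap L _ (ExteriorAlgebra.algebraMapInv x) ∈ evenOdd (0 : QuadraticForm L M) 0 :=
    fun x hx => sub_mem hx (SetLike.algebraMap_mem_graded (evenOdd (0 : QuadraticForm L M)) _)
  induction x, hx using even_induction with
  | algebraMap r =>
    change IsNilpotent (algebraMap L (ExteriorAlgebra L M) r - _)
    rw [AlgHom.commutes]
    simp
  | add x y hx hy ihx ihy =>
    rw [map_add, map_add, add_sub_add_comm]
    exact Commute.isNilpotent_add (exterior_even_comm _ (hmem x hx) _) ihx ihy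
  | ι_mul_ι_mul v w x hx ihx =>
    change IsNilpotent (ExteriorAlgebra.ι L v * ExteriorAlgebra.ι L w * x - algebraMap L _
      (ExteriorAlgebra.algebraMapInv (ExteriorAlgebra.ι L v * ExteriorAlgebra.ι L w * x)))
    have h0 : ExteriorAlgebra.algebraMapInv (ExteriorAlgebra.ι L v) = 0 := by
      simp [ExteriorAlgebra.algebraMapInv]
    rw [map_mul ExteriorAlgebra.algebraMapInv, map_mul ExteriorAlgebra.algebraMapInv, h0, zero_mul,
      zero_mul, map_zero, sub_zero]
    have h2 : ExteriorAlgebra.ι L v * ExteriorAlgebra.ι L w *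
        (ExteriorAlgebra.ι L v * ExteriorAlgebra.ι L w) = 0 := by
      rw [mul_assoc, ← mul_assoc (ExteriorAlgebra.ι L w), exterior_ι_anticomm w v, neg_mul,
        mul_assoc _ _ (ExteriorAlgebra.ι L w), ExteriorAlgebra.ι_sq_zero]
      simp
    generalize ExteriorAlgebra.ι L v * ExteriorAlgebra.ι L w = e at h2
    refine ⟨2, ?_⟩
    rw [pow_two, mul_assoc, ← mul_assoc x, exterior_even_comm x hx, mul_assoc e x x, ← mul_assoc e,
      h2, zero_mul]

/-- The even component of a left inverse is already a left inverse, by comparing parities in `w * u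
= 1`. -/
theorem exists_even_mul_eq_one {K R : Type*} [CommRing K] [Ring R] [Algebra K R]
    (𝒜 : ZMod 2 → Submodule K R) [GradedAlgebra 𝒜] {u w : R} (hu : u ∈ 𝒜 0) (h : w * u = 1) :
    ∃ v ∈ 𝒜 0, v * u = 1 := by
  obtain ⟨y, hy, z, hz, rfl⟩ := exists_even_add_odd 𝒜 w
  refine ⟨y, hy, ?_⟩
  have hd := ((DirectSum.Decomposition.isInternal 𝒜).isCompl (i := 0) (j := 1) zero_ne_one
    univ_zmod_two).disjoint
  have h0 : z * u ∈ 𝒜 0 := by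
    rw [add_mul, add_comm, ← eq_sub_iff_add_eq] at h
    rw [h]
    exact sub_mem SetLike.GradedOne.one_mem (SetLike.mul_mem_graded (A := 𝒜) hy hu)
  have h1 : z * u ∈ 𝒜 1 := SetLike.mul_mem_graded (A := 𝒜) hz hu
  rw [add_mul, Submodule.disjoint_def.1 hd _ h0 h1, add_zero] at h
  exact h

theorem exterior_exists_even_mul_eq_one {x : ExteriorAlgebra L M}
    (hx : x ∈ exteriorGrading K L M 0) (h : IsUnit (ExteriorAlgebra.algebraMapInv x)) :
    ∃ w ∈ exteriorGrading K L M 0, w * x = 1 := by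
  have hn := exterior_isNilpotent_sub_algebraMap x hx
  have hu : IsUnit (algebraMap L _ (ExteriorAlgebra.algebraMapInv x) +
      (x - algebraMap L (ExteriorAlgebra L M) (ExteriorAlgebra.algebraMapInv x))) :=
    hn.isUnit_add_left_of_commute (h.map _) (Algebra.commutes _ _).symm
  rw [add_sub_cancel] at hu
  obtain ⟨w, hw⟩ := hu.exists_left_inv
  exact exists_even_mul_eq_one _ hx hw

/-- Multiplying the top form by a vector gives an alternating product of `q + 1` vectors in rank
`q`, which is zero; only the body of `x` acts. -/
theorem exterior_mul_top {q : ℕ} (x : ExteriorAlgebra L (Fin q → L)) :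
    x * ExteriorAlgebra.ιMulti L q (fun k => Pi.single k 1) =
      ExteriorAlgebra.algebraMapInv x •
        ExteriorAlgebra.ιMulti L q (fun k => (Pi.single k 1 : Fin q → L)) := by
  induction x using ExteriorAlgebra.induction with
  | algebraMap r => rw [AlgHom.commutes, Algebra.smul_def]; rfl
  | ι v =>
    have h0 : ExteriorAlgebra.algebraMapInv (ExteriorAlgebra.ι L v) = 0 := by
      simp [ExteriorAlgebra.algebraMapInv]
    rw [h0, zero_smul]
    have h1 : ExteriorAlgebra.ιMulti L (q + 1) (M := Fin q → L) = 0 :=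
      Module.Basis.ext_alternating (Pi.basisFun L (Fin q)) fun w hw => by
        have := Fintype.card_le_of_injective w hw
        simp at this
    have := DFunLike.congr_fun h1 (Fin.cons v fun k => Pi.single k 1)
    rw [ExteriorAlgebra.ιMulti_succ_apply] at this
    simpa [Matrix.vecTail, Function.comp_def] using this
  | mul a b ha hb => rw [mul_assoc, hb, mul_smul_comm, ha, smul_smul, map_mul, mul_comm]
  | add a b ha hb => rw [add_mul, ha, hb, map_add, add_smul]

theorem exterior_smul_top_eq_zero {q : ℕ} {c : L}
    (h : c • ExteriorAlgebra.ιMulti L q (fun k => (Pi.single k 1 : Fin q → L)) = 0) : c = 0 := by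
  -- The determinant in degree `q` and zero elsewhere: the resulting functional takes the value `1`
  -- on the top form.
  let f : ∀ i, (Fin q → L) [⋀^Fin i]→ₗ[L] L := fun i =>
    if hi : q = i then hi ▸ (Matrix.detRowAlternating (n := Fin q) (R := L)) else 0
  have h1 := congrArg (ExteriorAlgebra.liftAlternating f) h
  rw [map_smul, ExteriorAlgebra.liftAlternating_apply_ιMulti, map_zero] at h1
  have h2 : f q = Matrix.detRowAlternating := by simp [f]
  rw [h2] at h1
  have h3 : (fun k => (Pi.single k 1 : Fin q → L)) = (1 : Matrix (Fin q) (Fin q) L) := by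
    ext i j
    simp [Matrix.one_apply, Pi.single_apply, eq_comm]
  rw [h3] at h1
  rwa [show Matrix.detRowAlternating (1 : Matrix (Fin q) (Fin q) L) = 1 from Matrix.det_one,
    smul_eq_mul, mul_one] at h1

end Exterior

/-! ### Nonvanishing of the continuant. -/

/-- The all-zero sequence would fail for odd `m`. With `a_0 = 1` both tracked entries only change
sign and place after the first factor; the `0 1` entry vanishes for `k = 0`, hence the disjunction.
-/
theorem hillProd_one_one_ne_zero (K : Type*) [Field K] (m : ℕ) :
    hillProd (fun i : ℤ => if i = 0 then (1 : K) else 0) (fun _ => 0) 0 m 1 1 ≠ 0 := by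
  have h : ∀ k, (k = 0 ∨ hillProd (fun i : ℤ => if i = 0 then (1 : K) else 0) (fun _ => 0) 0 k 0 1
      ≠ 0) ∧ hillProd (fun i : ℤ => if i = 0 then (1 : K) else 0) (fun _ => 0) 0 k 1 1 ≠ 0 := by
    intro k
    induction k with
    | zero => simp [hillProd]
    | succ k ih =>
      obtain ⟨h1, h2⟩ := ih
      rcases Nat.eq_zero_or_pos k with rfl | hk
      · simp [hillProd, hillMatrix]
      · have h1 := h1.resolve_left hk.ne'
        rw [hillProd]
        simp [hillMatrix, Matrix.mul_apply, Fin.sum_univ_three, h1, h2, hk.ne']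
  exact (h m).2

/-- The general continuant is not zero. -/
theorem hillProd_X_ne_zero (K : Type*) [Field K] (m : ℕ) {x : ℤ → MvPolynomial (Fin m) K}
    (hx : ∀ k : Fin m, x (k : ℕ) = MvPolynomial.X k) : hillProd x (fun _ => 0) 0 m 1 1 ≠ 0 := by
  intro h
  let φ : MvPolynomial (Fin m) K →+* K :=
    MvPolynomial.eval fun k : Fin m => if (k : ℕ) = 0 then (1 : K) else 0
  have h1 := congrFun₂ (hillProd_map φ x (fun _ => 0) 0 m) 1 1
  rw [Matrix.map_apply, h, map_zero] at h1
  refine hillProd_one_one_ne_zero K m ?_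
  refine Eq.trans ?_ h1.symm
  refine congrFun₂ (hillProd_congr (fun l hl => ?_) (fun _ _ => rfl)) 1 1
  have := hx ⟨l, hl⟩
  simp only at this
  simp [φ, this]

/-! ### The generic superfrieze and the superdimension. -/

section Superdimension

variable (K : Type u) [Field K] (m : ℕ)

/-- The generic superfrieze detects a prime ideal of coheight at least `m` above the annihilator of
`β_0 ⋯ β_m`. -/
theorem exists_isPrime_annihilator_le :
    ∃ P : Ideal (superfriezeVariety K m).Even, P.IsPrime ∧
      (superfriezeVariety K m).evenAnnihilator
        (List.ofFn fun k : Fin (m + 1) => superfriezeB K m (k : ℕ)).prod ≤ P ∧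
      (m : WithBot ℕ∞) ≤ ringKrullDim ((superfriezeVariety K m).Even ⧸ P) := by
  let S := MvPolynomial (Fin m) K
  let L := FractionRing S
  let x₀ : ℤ → S := fun i => if h : i.toNat < m then MvPolynomial.X ⟨i.toNat, h⟩ else 0
  let x : ℤ → ExteriorAlgebra L (Fin (m + 1) → L) := fun i => algebraMap L _ (algebraMap S L (x₀ i))
  let θ : ℤ → ExteriorAlgebra L (Fin (m + 1) → L) := fun i =>
    if h : i.toNat < m + 1 then ExteriorAlgebra.ι L (Pi.single ⟨i.toNat, h⟩ 1) else 0
  let 𝒜 := exteriorGrading K L (Fin (m + 1) → L)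
  have hx : ∀ i, x i ∈ 𝒜 0 := fun i =>
    SetLike.algebraMap_mem_graded (CliffordAlgebra.evenOdd _) _
  have hθ : ∀ i, θ i ∈ 𝒜 1 := fun i => by
    by_cases h : i.toNat < m + 1
    · simp only [θ, dif_pos h]
      exact CliffordAlgebra.ι_mem_evenOdd_one _ _
    · simp only [θ, dif_neg h]
      exact zero_mem _
  let body : ExteriorAlgebra L (Fin (m + 1) → L) →ₐ[L] L := ExteriorAlgebra.algebraMapInv
  have hbx : ∀ i, body (x i) = algebraMap S L (x₀ i) := fun i => AlgHom.commutes _ _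
  have hbθ : ∀ i, body (θ i) = 0 := fun i => by
    by_cases h : i.toNat < m + 1
    · simp only [θ, dif_pos h]
      simp [body, ExteriorAlgebra.algebraMapInv]
    · simp only [θ, dif_neg h, map_zero]
  have hunit : IsUnit (body (hillProd x θ 0 m 1 1)) := by
    have h1 := congrFun₂ (hillProd_map body.toRingHom x θ 0 m) 1 1
    have h2 := congrFun₂ (hillProd_map (algebraMap S L) x₀ (fun _ => 0) 0 m) 1 1
    simp only [Matrix.map_apply, AlgHom.toRingHom_eq_coe, RingHom.coe_coe, hbx, hbθ] at h1
    simp only [Matrix.map_apply, map_zero] at h2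
    rw [h1, ← h2, isUnit_iff_ne_zero]
    refine (map_ne_zero_iff _ (IsFractionRing.injective S L)).2 (hillProd_X_ne_zero K m fun k => ?_)
    simp [x₀]
  obtain ⟨w, hw, hw1⟩ := exterior_exists_even_mul_eq_one K (isSOSp_hillProd hx hθ 0 m).even11 hunit
  obtain ⟨a, b, hab, hax, hbθ'⟩ := exists_isSuperfrieze hx hθ hw hw1
  obtain ⟨φ, ⟨-, hφ⟩, -⟩ := (isSpaceOfSuperfriezes.{u, u} K m).2 _ 𝒜 a b hab
  -- Evaluation at the generic superfrieze followed by the body map lands in a field, so its kernel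
  -- is prime.
  let ψ : (superfriezeVariety K m).Even →ₐ[K] L :=
    ((body.restrictScalars K).comp φ).comp (superfriezeVariety K m).evenVal
  have hP : (RingHom.ker ψ).IsPrime := RingHom.ker_isPrime ψ
  refine ⟨RingHom.ker ψ, hP, fun r hr => ?_, ?_⟩
  · have h1 : φ (r : (superfriezeVariety K m).coord) *
        φ (List.ofFn fun k : Fin (m + 1) => superfriezeB K m (k : ℕ)).prod = 0 := by
      rw [← map_mul]
      exact (congrArg φ hr).trans (map_zero φ)
    have h2 : φ (List.ofFn fun k : Fin (m + 1) => superfriezeB K m (k : ℕ)).prod =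
        ExteriorAlgebra.ιMulti L (m + 1) (fun k => Pi.single k 1) := by
      rw [map_list_prod, List.map_ofFn, ExteriorAlgebra.ιMulti_apply]
      congr 2
      ext k
      rw [Function.comp_apply, (hφ _).2, hbθ' k k.2]
      simp only [θ, Int.toNat_natCast, dif_pos k.2]
    -- If `r` kills `β_0 ⋯ β_m`, then the body of its image kills the top form and is therefore
    -- zero.
    rw [h2, exterior_mul_top] at h1
    exact exterior_smul_top_eq_zero h1
  · have := finiteType_even_quotient K m (RingHom.ker ψ)
    let A : Fin m → (superfriezeVariety K m).Even := fun k =>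
      ⟨superfriezeA K m (k : ℕ), (superfrieze_isSuperfrieze K m).even_mem _⟩
    have hA : ∀ k, ψ (A k) = algebraMap S L (MvPolynomial.X k) := fun k => by
      change body (φ (superfriezeA K m (k : ℕ))) = _
      rw [(hφ _).1, hax k k.2, hbx]
      simp [x₀]
    refine le_ringKrullDim_of_algebraicIndependent (K := K)
      (x := fun k => Ideal.Quotient.mk (RingHom.ker ψ) (A k)) ?_
    refine AlgebraicIndependent.of_comp (Ideal.kerLiftAlg ψ) ?_
    have : (Ideal.kerLiftAlg ψ) ∘ (fun k => Ideal.Quotient.mk (RingHom.ker ψ) (A k)) =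
        fun k => IsScalarTower.toAlgHom K S L (MvPolynomial.X k) := by
      ext k
      exact (hA k)
    rw [this]
    exact (MvPolynomial.algebraicIndependent_X (Fin m) K).map' (IsFractionRing.injective S L)

theorem superfriezeVariety_hasSuperdimension :
    (superfriezeVariety K m).HasSuperdimension m (m + 1) := by
  obtain ⟨P, hP, hle, hdim⟩ := exists_isPrime_annihilator_le K m
  have hV : ringKrullDim (superfriezeVariety K m).Even = m :=
    le_antisymm (ringKrullDim_superfriezeVariety_even_le K m)
      (hdim.trans (ringKrullDim_quotient_le P))
  refine ⟨hV, ⟨fun k : Fin (m + 1) => superfriezeB K m (k : ℕ),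
    fun k => (superfrieze_isSuperfrieze K m).odd_mem _, ?_⟩, ?_⟩
  · refine le_antisymm (ringKrullDim_quotient_le _) ?_
    rw [hV]
    exact hdim.trans (ringKrullDim_le_of_surjective _ (Ideal.Quotient.factor_surjective hle))
  · rintro s ⟨y, hy, hs⟩
    by_contra! hlt
    have htop : (superfriezeVariety K m).evenAnnihilator (List.ofFn y).prod = ⊤ := by
      refine eq_top_iff.2 fun r _ => ?_
      change (r : (superfriezeVariety K m).coord) * (List.ofFn y).prod = 0
      rw [superfriezeVariety_prod_odd_eq_zero K m hlt hy, mul_zero]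
    have := Ideal.Quotient.subsingleton_iff.2 htop
    -- The zero ring has dimension `⊥`, which differs from `m` even when `m = 0`.
    rw [ringKrullDim_eq_bot_of_subsingleton, hV] at hs
    exact absurd hs (by simp)

end Superdimension

theorem mainTheorem3 {K : Type u} [Field K] (m : ℕ) :
    IsSpaceOfSuperfriezes.{u, v} m (superfriezeVariety K m) (superfriezeA K m) (superfriezeB K m) ∧
      (superfriezeVariety K m).HasSuperdimension m (m + 1) :=
  ⟨isSpaceOfSuperfriezes K m, superfriezeVariety_hasSuperdimension K m⟩
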